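/- Let $p>1$. There is a constant $\mu_0=\mu_0(p)>1$, depending only on $p$, with the following property. Let $0<T<\infty$ and let $X:\mathbb S^1\times[0,T)\to\mathbb R^2$ be a smooth family of embeddings $X(\cdot,t)$ such that each closed curve $M_t=X(\mathbb S^1,t)$ bounds a convex open region $\Omega_t$, and suppose that it evolves by the power curvature flow $$\frac{\partial X}{\partial t}(x,t)=-\kappa(x,t)^p\,\nu(x,t),\qquad x\in\mathbb S^1,\ t\in[0,T),$$ where $\nu(\cdot,t)$ is the outward unit normal of $M_t$ and $\kappa(\cdot,t)\ge 0$ is its curvature (so that a circle of radius $r$ has $\kappa=1/r$). For $\mu\ge 1$ call $M_t$ *$\mu$-non-collapsed* if $\kappa(\cdot,t)>0$ and for every $x\in\mathbb S^1$ there is an open disc $B\subset\Omega_t$ of radius $\frac{1}{\mu\,\kappa(x,t)}$ with $X(x,t)\in\partial B$. If $1\le\mu\le\mu_0$ and $M_0$ is $\mu$-non-collapsed, then $M_t$ is $\mu$-non-collapsed for every $t\in[0,T)$. -/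

import Mathlib

open Set Filter Topology
open scoped Manifold ContDiff

noncomputable section

namespace PCF

/-- The Euclidean plane. -/
abbrev Plane : Type := EuclideanSpace ℝ (Fin 2)

/-- The `2π`-periodic parametrization `θ ↦ γ (e^{iθ})` of a closed curve `γ : 𝕊¹ → ℝ²`. -/
def lift (γ : Circle → Plane) (θ : ℝ) : Plane := γ (Circle.exp θ)

/-- The open region enclosed by a set `M` in the plane: the union of the bounded connected
components of its complement. For a Jordan curve this is its interior. -/
def enclosedRegion (M : Set Plane) : Set Plane :=
  {z | z ∈ Mᶜ ∧ Bornology.IsBounded (connectedComponentIn Mᶜ z)}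

/-- `γ : 𝕊¹ → ℝ²` is a smooth embedding (an injective smooth immersion of the circle)
whose image bounds a convex region. Convexity is not required to be strict. -/
structure IsConvexEmbedding (γ : Circle → Plane) : Prop where
  smooth : ContMDiff (𝓡 1) 𝓘(ℝ, Plane) ∞ γ
  injective : Function.Injective γ
  immersion : ∀ θ : ℝ, deriv (lift γ) θ ≠ 0
  convex : Convex ℝ (enclosedRegion (range γ))

/-- `n` is the outward unit normal of the closed embedded curve `γ` at the point `γ (e^{iθ})`:
a unit vector orthogonal to the tangent such that `-n` points into the enclosed region. -/
structure IsOutwardUnitNormal (γ : Circle → Plane) (θ : ℝ) (n : Plane) : Prop where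
  norm_eq_one : ‖n‖ = 1
  orthogonal : inner ℝ n (deriv (lift γ) θ) = 0
  outward : ∀ᶠ s : ℝ in 𝓝[>] 0, lift γ θ - s • n ∈ enclosedRegion (range γ)

/-- The curvature `κ = -⟨γ'', ν⟩ / |γ'|²` of `γ` at `γ (e^{iθ})` with respect to the unit normal
field `ν`; for the outward normal a circle of radius `r` has `κ = 1 / r`. -/
def curvature (γ ν : Circle → Plane) (θ : ℝ) : ℝ :=
  -inner ℝ (deriv (deriv (lift γ)) θ) (lift ν θ) / ‖deriv (lift γ) θ‖ ^ 2

/-- The curve `γ` with outward unit normal field `ν` is `μ`-non-collapsed: its curvature `κ` is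
positive and at each of its points it is touched from inside by a disc of radius `1 / (μ κ)`,
i.e. an open disc of that radius is contained in the enclosed region and has the point on its
boundary. -/
def IsNonCollapsed (μ : ℝ) (γ ν : Circle → Plane) : Prop :=
  ∀ θ : ℝ, 0 < curvature γ ν θ ∧
    ∃ c : Plane,
      Metric.ball c (1 / (μ * curvature γ ν θ)) ⊆ enclosedRegion (range γ) ∧
      lift γ θ ∈ Metric.sphere c (1 / (μ * curvature γ ν θ))

/-- `X : 𝕊¹ × [0, T) → ℝ²` is a smooth family of convex embeddings, with outward unit normals `ν`,
which evolves by the power curvature flow `∂X/∂t = -κ^p ν` (with the one-sided time derivative at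
`t = 0`). The values of `X` and `ν` outside `[0, T)` play no role. -/
structure IsConvexPowerCurvatureFlow (p T : ℝ) (X ν : Circle → ℝ → Plane) : Prop where
  smooth : ContMDiffOn ((𝓡 1).prod 𝓘(ℝ, ℝ)) 𝓘(ℝ, Plane) ∞
    (fun q : Circle × ℝ => X q.1 q.2) (univ ×ˢ Ico 0 T)
  convexEmbedding : ∀ t ∈ Ico 0 T, IsConvexEmbedding (fun z => X z t)
  normal : ∀ t ∈ Ico 0 T, ∀ θ : ℝ,
    IsOutwardUnitNormal (fun z => X z t) θ (ν (Circle.exp θ) t)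
  flow : ∀ t ∈ Ico 0 T, ∀ θ : ℝ,
    HasDerivWithinAt (fun s => X (Circle.exp θ) s)
      (-(curvature (fun z => X z t) (fun z => ν z t) θ ^ p) • ν (Circle.exp θ) t) (Ico 0 T) t

end PCF

end

noncomputable section

namespace PCF

/-! The proof is a two-point maximum principle. Put Z(θ, φ, t) = 2⟨X(θ) - X(φ), ν(θ)⟩ - μ κ(θ) |X(θ)
- X(φ)|². The disc of radius 1/(μκ(θ)) tangent from inside at θ misses X(φ) exactly when Z ≤ 0, so
non-collapsing is Z ≤ 0 everywhere (`isNonCollapsed_iff`); positive curvature then comes for free,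
because every tangent line has curve points strictly on its inner side (`curvature_pos`).

Take μ > 1 and suppose Z ≤ 0 at time t. Where Z < 0, continuity suffices. On the diagonal the second
arclength derivative of Z in φ is 2κ(1 - μ) < 0, which keeps Z ≤ 0 nearby. At an off-diagonal zero
the disc touches the curve a second time. There Z is at a spatial maximum, and the first- and
second-order conditions, inserted into the evolution equations of X, ν and κ, give ∂ₜZ < 0
(`time_derivative_neg`, `twoPointDt_neg`). Compactness of the parameter square then propagates Z ≤ 0
to slightly later times, and a continuity argument covers [0, T). The case μ = 1 is the limit μ ↓ 1.

The smallness of μ₀ enters only through the sign of ∂ₜZ. The Hessian is tested in the arclength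
direction (1, -1/√p). What remains is controlled by μ^p - 1 + (μ - 1)(p - 2(p - 1)/μ - 2√p), which
behaves like (μ - 1)(2 - 2√p) as μ ↓ 1 and is therefore negative when p > 1.

The flow supplies no regularity for ν, so the smoothness of ν and κ in space-time has to be
recovered first, by showing that the orientation of the parametrization is constant. -/

/-- The space-time domain `ℝ × [0, T)` of a lifted flow. -/
def strip (T : ℝ) : Set (ℝ × ℝ) := univ ×ˢ Ico 0 T

/-- The spatial derivative of a function on the strip. -/
def dθ (T : ℝ) (F : ℝ × ℝ → ℝ) (q : ℝ × ℝ) : ℝ := fderivWithin ℝ F (strip T) q (1, 0)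

/-- The time derivative (one-sided at `t = 0`) of a function on the strip. -/
def dt (T : ℝ) (F : ℝ × ℝ → ℝ) (q : ℝ × ℝ) : ℝ := fderivWithin ℝ F (strip T) q (0, 1)

/-! ### Calculus on the space-time strip, one-sided at the initial time -/

section stripCalculus

variable {T : ℝ} {F : ℝ × ℝ → ℝ}

theorem mem_strip {θ t : ℝ} : (θ, t) ∈ strip T ↔ t ∈ Ico 0 T := by simp [strip]

theorem uniqueDiffOn_strip : UniqueDiffOn ℝ (strip T) :=
  uniqueDiffOn_univ.prod (uniqueDiffOn_Ico 0 T)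

theorem strip_subset_closure_interior (hT : 0 < T) : strip T ⊆ closure (interior (strip T)) := by
  rw [strip, interior_prod_eq, closure_prod_eq, interior_univ, closure_univ, interior_Ico,
    closure_Ioo hT.ne]
  exact prod_mono le_rfl Ico_subset_Icc_self

theorem contDiffOn_dθ (hF : ContDiffOn ℝ ∞ F (strip T)) : ContDiffOn ℝ ∞ (dθ T F) (strip T) :=
  (hF.fderivWithin uniqueDiffOn_strip (by simp)).clm_apply contDiffOn_const

theorem contDiffOn_dt (hF : ContDiffOn ℝ ∞ F (strip T)) : ContDiffOn ℝ ∞ (dt T F) (strip T) :=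
  (hF.fderivWithin uniqueDiffOn_strip (by simp)).clm_apply contDiffOn_const

theorem hasFDerivWithinAt_strip (hF : ContDiffOn ℝ ∞ F (strip T)) {q : ℝ × ℝ} (hq : q ∈ strip T) :
    HasFDerivWithinAt F (fderivWithin ℝ F (strip T) q) (strip T) q :=
  (hF.differentiableOn (by simp) q hq).hasFDerivWithinAt

theorem hasDerivAt_dθ (hF : ContDiffOn ℝ ∞ F (strip T)) {t : ℝ} (ht : t ∈ Ico 0 T) (θ : ℝ) :
    HasDerivAt (fun s => F (s, t)) (dθ T F (θ, t)) θ := by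
  have h1 : HasDerivAt (fun s : ℝ => (s, t)) ((1 : ℝ), (0 : ℝ)) θ :=
    (hasDerivAt_id θ).prodMk (hasDerivAt_const θ t)
  have h2 := (hasFDerivWithinAt_strip hF (mem_strip.2 ht : (θ, t) ∈ strip T)).comp_hasDerivWithinAt
    (s := univ) θ h1.hasDerivWithinAt (fun s _ => mem_strip.2 ht)
  exact hasDerivWithinAt_univ.1 h2

theorem hasDerivWithinAt_dt (hF : ContDiffOn ℝ ∞ F (strip T)) {t : ℝ} (ht : t ∈ Ico 0 T) (θ : ℝ) :
    HasDerivWithinAt (fun s => F (θ, s)) (dt T F (θ, t)) (Ico 0 T) t := by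
  have h1 : HasDerivAt (fun s : ℝ => (θ, s)) ((0 : ℝ), (1 : ℝ)) t :=
    (hasDerivAt_const t θ).prodMk (hasDerivAt_id t)
  exact (hasFDerivWithinAt_strip hF (mem_strip.2 ht : (θ, t) ∈ strip T)).comp_hasDerivWithinAt
    (s := Ico 0 T) t h1.hasDerivWithinAt (fun s hs => mem_strip.2 hs)

theorem dθ_eq_of_hasDerivAt (hF : ContDiffOn ℝ ∞ F (strip T)) {t θ F' : ℝ} (ht : t ∈ Ico 0 T)
    (h : HasDerivAt (fun s => F (s, t)) F' θ) : dθ T F (θ, t) = F' :=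
  (hasDerivAt_dθ hF ht θ).unique h

theorem dt_eq_of_hasDerivWithinAt (hF : ContDiffOn ℝ ∞ F (strip T)) {t θ F' : ℝ}
    (ht : t ∈ Ico 0 T) (h : HasDerivWithinAt (fun s => F (θ, s)) F' (Ico 0 T) t) :
    dt T F (θ, t) = F' :=
  (uniqueDiffOn_Ico 0 T t ht).eq_deriv _ (hasDerivWithinAt_dt hF ht θ) h

/-- Space and time derivatives commute, up to the initial time. -/
theorem dθ_dt_comm (hT : 0 < T) (hF : ContDiffOn ℝ ∞ F (strip T)) {q : ℝ × ℝ} (hq : q ∈ strip T) :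
    dθ T (dt T F) q = dt T (dθ T F) q := by
  have hs : IsSymmSndFDerivWithinAt ℝ F (strip T) q :=
    (hF q hq).isSymmSndFDerivWithinAt
      (by simpa using WithTop.coe_le_coe.2 (le_top : (2 : ℕ∞) ≤ ⊤)) uniqueDiffOn_strip
      (strip_subset_closure_interior hT hq) hq
  have hd : DifferentiableWithinAt ℝ (fderivWithin ℝ F (strip T)) (strip T) q :=
    (hF.fderivWithin uniqueDiffOn_strip (m := ∞) (by simp)).differentiableOn (by simp) q hq
  have hu := uniqueDiffOn_strip q hq
  have key : ∀ a b : ℝ × ℝ, fderivWithin ℝ (fun z => fderivWithin ℝ F (strip T) z a) (strip T) q b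
      = fderivWithin ℝ (fderivWithin ℝ F (strip T)) (strip T) q b a := by
    intro a b
    have := (hd.hasFDerivWithinAt.clm_apply (hasFDerivWithinAt_const a q (strip T))).fderivWithin hu
    rw [this]; simp
  change fderivWithin ℝ (fun z => fderivWithin ℝ F (strip T) z (0, 1)) (strip T) q (1, 0) =
    fderivWithin ℝ (fun z => fderivWithin ℝ F (strip T) z (1, 0)) (strip T) q (0, 1)
  rw [key, key]
  exact hs _ _

end stripCalculus

/-! ### The pinching constant and the reaction inequality -/

/-- The pinching constant: for ratios slightly above one, the reaction terms have a sign. -/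
theorem exists_pinching_constant {p : ℝ} (hp : 1 < p) : ∃ μ₀ : ℝ, 1 < μ₀ ∧
    ∀ μ, 1 < μ → μ ≤ μ₀ →
      μ ^ p - 1 + (μ - 1) * (p - 2 * (p - 1) / μ - 2 * √p) < 0 := by
  have hd : HasDerivAt (fun μ : ℝ => μ ^ p) p 1 := by
    simpa using Real.hasDerivAt_rpow_const (x := 1) (p := p) (Or.inl one_ne_zero)
  have h1 : Tendsto (slope (fun μ : ℝ => μ ^ p) 1) (𝓝[>] 1) (𝓝 p) :=
    (hasDerivAt_iff_tendsto_slope.1 hd).mono_left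
      (nhdsWithin_mono _ fun y hy => ne_of_gt hy)
  have h2 : Tendsto (fun μ : ℝ => p - 2 * (p - 1) / μ - 2 * √p) (𝓝[>] 1)
      (𝓝 (p - 2 * (p - 1) / 1 - 2 * √p)) := by
    refine Tendsto.mono_left (ContinuousAt.tendsto (f := fun μ : ℝ => p - 2 * (p - 1) / μ - 2 * √p)
      ?_) nhdsWithin_le_nhds
    fun_prop (disch := norm_num)
  have hsq : 1 < √p := by rw [Real.lt_sqrt] <;> linarith
  -- After division by μ - 1 the expression tends to p + p - 2(p - 1) - 2√p = 2 - 2√p < 0.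
  have h3 := (h1.add h2).eventually_lt_const (u := 0) (by linarith)
  obtain ⟨u, hu, hsub⟩ := mem_nhdsGT_iff_exists_Ioc_subset.1 h3
  refine ⟨u, hu, fun μ hμ hμu => ?_⟩
  have := hsub ⟨hμ, hμu⟩
  simp only [mem_ofPred_eq, slope_def_field, Real.one_rpow] at this
  have h0 : 0 < μ - 1 := by linarith
  have h4 := mul_neg_of_pos_of_neg h0 this
  rw [mul_add, mul_div_cancel₀ _ h0.ne'] at h4
  exact h4

/-- The algebraic inequality behind the maximum principle: at a spatial maximum of the two-point
function `2⟨X(x) - X(y), ν(x)⟩ - μ κ(x) |X(x) - X(y)|²` with value zero, its time derivative is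
negative. Here `D = |X(x) - X(y)|²`, `a = ⟨X(x) - X(y), T(x)⟩`, `κ` and `q` are the curvatures
at `x` and `y`, and `w`, `w'` are the first two arclength derivatives of `κ` at `x`. -/
theorem time_derivative_neg {p μ κ q D a w w' : ℝ} (hp : 1 < p) (hμ : 1 < μ)
    (hpinch : μ ^ p - 1 + (μ - 1) * (p - 2 * (p - 1) / μ - 2 * √p) < 0)
    (hκ : 0 < κ) (hq : 0 ≤ q) (hqκ : q ≤ μ * κ) (hD : 0 < D)
    (ha : a ^ 2 = D - (μ * κ * D / 2) ^ 2)
    (hw : μ * w * D = 2 * (κ - μ * κ) * a)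
    (hess : (2 * w * a + 2 * (κ - μ * κ) * (1 - κ * (μ * κ * D / 2)) - μ * w' * D - 4 * μ * w * a)
      + 2 * (-1 / √p) * (-2 * (μ * κ - κ)) + (-1 / √p) ^ 2 * (2 * q - 2 * (μ * κ)) ≤ 0) :
    2 * q ^ p - 2 * κ ^ p * (1 - (μ * κ) ^ 2 * D / 2) + 2 * (p * κ ^ (p - 1) * w) * a
      - μ * D * (p * κ ^ (p - 1) * w' + p * (p - 1) * κ ^ (p - 2) * w ^ 2 + κ ^ 2 * κ ^ p) < 0 := by
  have hp0 : 0 < p := by linarith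
  have hμ0 : 0 < μ := by linarith
  set A := κ ^ (p - 1) with hA
  have hA0 : 0 < A := Real.rpow_pos_of_pos hκ _
  have hκp : κ ^ p = A * κ := by
    rw [hA, ← Real.rpow_add_one hκ.ne']; ring_nf
  have hB0 : 0 < κ ^ (p - 2) := Real.rpow_pos_of_pos hκ _
  have hs0 : 0 < √p := Real.sqrt_pos.2 hp0
  have hs2 : √p * √p = p := Real.mul_self_sqrt hp0.le
  set s := √p with hs
  -- the chord bound for the convex function `q ↦ q ^ p`
  have hM : μ ^ p = μ ^ (p - 1) * μ := by rw [← Real.rpow_add_one hμ0.ne']; ring_nf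
  have hM1 : 1 ≤ μ ^ (p - 1) := Real.one_le_rpow hμ.le (by linarith)
  have hchord : q ^ p ≤ μ ^ (p - 1) * A * q := by
    rcases hq.eq_or_lt with h0 | h0
    · rw [← h0, Real.zero_rpow hp0.ne']; simp
    · have : q ^ p = q ^ (p - 1) * q := by rw [← Real.rpow_add_one h0.ne']; ring_nf
      rw [this, hA, ← Real.mul_rpow hμ0.le hκ.le]
      exact mul_le_mul_of_nonneg_right (Real.rpow_le_rpow hq hqκ (by linarith)) hq
  set M := μ ^ (p - 1) with hMdef
  rw [hM] at hpinch
  rw [hκp]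
  -- The chord is at most the diameter 2/(μκ) of the touching disc.
  have hD4 : (μ * κ) ^ 2 * D ≤ 4 := by
    have : 0 ≤ D * (4 - (μ * κ) ^ 2 * D) := by linarith [sq_nonneg a]
    have := nonneg_of_mul_nonneg_right this hD
    linarith
  have hwa : w * a = -(2 * (μ - 1) * κ * (1 - (μ * κ) ^ 2 * D / 4)) / μ := by
    have h1 : (μ * D) * (w * a) = (μ * D) * (-(2 * (μ - 1) * κ * (1 - (μ * κ) ^ 2 * D / 4)) / μ) := by
      have : (μ * D) * (-(2 * (μ - 1) * κ * (1 - (μ * κ) ^ 2 * D / 4)) / μ) =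
        D * (-(2 * (μ - 1) * κ * (1 - (μ * κ) ^ 2 * D / 4))) := by field_simp
      rw [this]
      linear_combination a * hw + 2 * (κ - μ * κ) * ha
    exact mul_left_cancel₀ (by positivity) h1
  have hs1 : p * (-1 / s) = -s := by rw [← hs2]; field_simp
  have hs2' : p * (-1 / s) ^ 2 = 1 := by rw [← hs2]; field_simp
  -- The second component c = -1/√p satisfies p c² = 1, so multiplying by p leaves exactly 2q - 2μκ
  -- from the second point. Its negative sign matches that of the mixed derivative -2(μκ - κ), which
  -- yields the favourable term 4√p(μ - 1)κ.
  have hess' : p * (2 * (w * a) - 2 * (μ - 1) * κ * (1 - κ * (μ * κ * D / 2)) - μ * w' * D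
      - 4 * μ * (w * a)) + 4 * s * (μ - 1) * κ + 2 * q - 2 * (μ * κ) ≤ 0 := by
    have := mul_nonpos_of_nonneg_of_nonpos hp0.le hess
    have e : p * ((2 * w * a + 2 * (κ - μ * κ) * (1 - κ * (μ * κ * D / 2)) - μ * w' * D
      - 4 * μ * w * a) + 2 * (-1 / s) * (-2 * (μ * κ - κ)) + (-1 / s) ^ 2 * (2 * q - 2 * (μ * κ)))
      = p * (2 * (w * a) - 2 * (μ - 1) * κ * (1 - κ * (μ * κ * D / 2)) - μ * w' * D
      - 4 * μ * (w * a)) + 4 * s * (μ - 1) * κ + 2 * q - 2 * (μ * κ) := by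
      linear_combination (-4 * (μ * κ - κ)) * hs1 + (2 * q - 2 * (μ * κ)) * hs2'
    linarith
  have hess'' := mul_le_mul_of_nonneg_left hess' hA0.le
  have hwsq : 0 ≤ μ * D * (p * (p - 1) * κ ^ (p - 2) * w ^ 2) := by
    have : 0 < p - 1 := by linarith
    positivity
  -- The deficit μκ - q split off here cancels the one left by the Hessian inequality.
  have hMq : M * A * q ≤ A * (M * μ * κ - (μ * κ - q)) := by
    linarith [mul_nonneg hA0.le (mul_nonneg (sub_nonneg.2 hM1) (sub_nonneg.2 hqκ))]
  -- collect the terms and use `(μ κ)² D ≤ 4`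
  have hfin : 2 * (M * μ - 1) + (μ - 1) * (-6 * p - 4 * s)
      + (μ - 1) * ((2 * p * μ ^ 2 + (1 - p) * μ) * (κ ^ 2 * D)) < 0 := by
    have hc : 0 ≤ 2 * p * μ + (1 - p) := by
      linarith [mul_pos hp0 (sub_pos.2 hμ)]
    have h1 : (2 * p * μ ^ 2 + (1 - p) * μ) * (κ ^ 2 * D) ≤ 4 * (2 * p + (1 - p) / μ) := by
      have : (2 * p * μ ^ 2 + (1 - p) * μ) * (κ ^ 2 * D)
          = (2 * p + (1 - p) / μ) * ((μ * κ) ^ 2 * D) := by field_simp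
      rw [this, mul_comm]
      refine mul_le_mul_of_nonneg_right hD4 ?_
      have : 2 * p + (1 - p) / μ = (2 * p * μ + (1 - p)) / μ := by field_simp
      rw [this]; positivity
    have h2 := mul_le_mul_of_nonneg_left h1 (sub_nonneg.2 hμ.le)
    -- With this bound the left side of `hfin` is at most twice the pinching expression.
    have h3 : 4 * (2 * p + (1 - p) / μ) = 8 * p - 2 * (2 * (p - 1) / μ) := by ring
    rw [h3] at h2
    linarith
  have hfin' := mul_neg_of_pos_of_neg (mul_pos hA0 hκ) hfin
  have hμwa : μ * (w * a) = -(2 * (μ - 1) * κ * (1 - (μ * κ) ^ 2 * D / 4)) := by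
    rw [hwa]; field_simp
  have hμwa' := congrArg (fun z => A * p * z) hμwa
  linarith

/-! ### Spatial derivatives of the two-point function and conditions at a maximum -/

/-- The second derivative at a local maximum is nonpositive. -/
theorem second_deriv_nonpos_of_isLocalMax {h h' : ℝ → ℝ} {x h₂ : ℝ} (hm : IsLocalMax h x)
    (hd : ∀ r, HasDerivAt h (h' r) r) (hd₂ : HasDerivAt h' h₂ x) : h₂ ≤ 0 := by
  by_contra! hpos
  have e : deriv h = h' := funext fun r => (hd r).deriv
  -- A positive second derivative makes the point a local minimum too, so `h` is locally constant
  -- and its second derivative vanishes, a contradiction.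
  have hmin : IsLocalMin h x := by
    refine isLocalMin_of_deriv_deriv_pos ?_ hm.deriv_eq_zero (hd x).continuousAt
    rw [e, hd₂.deriv]; exact hpos
  have hc : h =ᶠ[𝓝 x] fun _ => h x := by
    filter_upwards [hm, hmin] with y h1 h2 using le_antisymm h1 h2
  have hc' : h' =ᶠ[𝓝 x] fun _ => 0 := by
    have := hc.deriv
    rw [e] at this
    simpa using this
  have := hc'.deriv_eq
  rw [hd₂.deriv] at this
  simp at this
  linarith

/-- A plane curve `(x, y)` with unit normal `(n, m)`, signed speed `v` along the rotated normal
`(-m, n)`, curvature `κ`, and arclength derivatives `w`, `w'` of the curvature. -/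
structure FramedCurve where
  (x y n m v κ w w' : ℝ → ℝ)
  unit : ∀ θ, n θ ^ 2 + m θ ^ 2 = 1
  v_ne : ∀ θ, v θ ≠ 0
  v_diff : ∀ θ, DifferentiableAt ℝ v θ
  hx : ∀ θ, HasDerivAt x (-(v θ * m θ)) θ
  hy : ∀ θ, HasDerivAt y (v θ * n θ) θ
  hn : ∀ θ, HasDerivAt n (-(κ θ * v θ * m θ)) θ
  hm : ∀ θ, HasDerivAt m (κ θ * v θ * n θ) θ
  hκ : ∀ θ, HasDerivAt κ (v θ * w θ) θ
  hw : ∀ θ, HasDerivAt w (v θ * w' θ) θ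

namespace FramedCurve

variable (γ : FramedCurve) (μ : ℝ)

/-- The squared chord length. -/
def chordSq (θ φ : ℝ) : ℝ := (γ.x θ - γ.x φ) ^ 2 + (γ.y θ - γ.y φ) ^ 2

/-- The normal component of the chord. -/
def chordNormal (θ φ : ℝ) : ℝ := (γ.x θ - γ.x φ) * γ.n θ + (γ.y θ - γ.y φ) * γ.m θ

/-- The tangential component of the chord. -/
def chordTangent (θ φ : ℝ) : ℝ := -(γ.x θ - γ.x φ) * γ.m θ + (γ.y θ - γ.y φ) * γ.n θ

/-- The two-point function which is nonpositive exactly when the disc of radius `1 / (μ κ(θ))`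
touching from inside at `θ` does not contain the point at `φ`. -/
def twoPoint (θ φ : ℝ) : ℝ := 2 * γ.chordNormal θ φ - μ * γ.κ θ * γ.chordSq θ φ

/-- The arclength derivative of `twoPoint` in the first variable. -/
def twoPointFst (θ φ : ℝ) : ℝ :=
  2 * (γ.κ θ - μ * γ.κ θ) * γ.chordTangent θ φ - μ * γ.w θ * γ.chordSq θ φ

/-- The arclength derivative of `twoPoint` in the second variable. -/
def twoPointSnd (θ φ : ℝ) : ℝ :=
  -2 * (-γ.m φ * (γ.n θ - μ * γ.κ θ * (γ.x θ - γ.x φ))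
    + γ.n φ * (γ.m θ - μ * γ.κ θ * (γ.y θ - γ.y φ)))

/-- The second arclength derivative of `twoPoint` in the first variable. -/
def twoPointFstFst (θ φ : ℝ) : ℝ :=
  2 * (γ.w θ - μ * γ.w θ) * γ.chordTangent θ φ
    + 2 * (γ.κ θ - μ * γ.κ θ) * (1 - γ.κ θ * γ.chordNormal θ φ)
    - μ * γ.w' θ * γ.chordSq θ φ - 2 * μ * γ.w θ * γ.chordTangent θ φ

/-- The mixed arclength derivative of `twoPoint`. -/
def twoPointFstSnd (θ φ : ℝ) : ℝ :=
  -2 * (γ.κ θ - μ * γ.κ θ) * (γ.m θ * γ.m φ + γ.n θ * γ.n φ)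
    + 2 * μ * γ.w θ * (-(γ.x θ - γ.x φ) * γ.m φ + (γ.y θ - γ.y φ) * γ.n φ)

/-- The second arclength derivative of `twoPoint` in the second variable. -/
def twoPointSndSnd (θ φ : ℝ) : ℝ :=
  2 * γ.κ φ * (γ.n φ * (γ.n θ - μ * γ.κ θ * (γ.x θ - γ.x φ))
    + γ.m φ * (γ.m θ - μ * γ.κ θ * (γ.y θ - γ.y φ))) - 2 * μ * γ.κ θ

section path

variable (θ φ α β r : ℝ)

theorem hasDerivAt_comp_affine {h : ℝ → ℝ} {h' : ℝ → ℝ} (hh : ∀ θ, HasDerivAt h (h' θ) θ) :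
    HasDerivAt (fun r => h (θ + α * r)) (α * h' (θ + α * r)) r := by
  have h1 : HasDerivAt (fun r => θ + α * r) α r := by
    simpa using ((hasDerivAt_id r).const_mul α).const_add θ
  exact ((hh (θ + α * r)).comp r h1).congr_deriv (mul_comm _ _)

/-- Restricting to a line in the parameter plane reduces the two-variable maximum conditions to
one-variable calculus; the next two lemmas differentiate once more. -/
theorem hasDerivAt_twoPoint_path :
    HasDerivAt (fun r => γ.twoPoint μ (θ + α * r) (φ + β * r))
      (α * γ.v (θ + α * r) * γ.twoPointFst μ (θ + α * r) (φ + β * r)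
        + β * γ.v (φ + β * r) * γ.twoPointSnd μ (θ + α * r) (φ + β * r)) r := by
  have x1 := hasDerivAt_comp_affine θ α r γ.hx
  have y1 := hasDerivAt_comp_affine θ α r γ.hy
  have n1 := hasDerivAt_comp_affine θ α r γ.hn
  have m1 := hasDerivAt_comp_affine θ α r γ.hm
  have k1 := hasDerivAt_comp_affine θ α r γ.hκ
  have x2 := hasDerivAt_comp_affine φ β r γ.hx
  have y2 := hasDerivAt_comp_affine φ β r γ.hy
  have u1 := x1.sub x2
  have u2 := y1.sub y2
  have := (((u1.mul n1).add (u2.mul m1)).const_mul 2).sub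
    ((k1.const_mul μ).mul ((u1.pow 2).add (u2.pow 2)))
  refine this.congr_deriv ?_
  simp only [twoPointFst, twoPointSnd, chordTangent, chordSq, Pi.sub_apply, Pi.add_apply,
    Pi.pow_apply]
  push_cast
  ring

theorem hasDerivAt_twoPointFst_path :
    HasDerivAt (fun r => γ.twoPointFst μ (θ + α * r) (φ + β * r))
      (α * γ.v (θ + α * r) * γ.twoPointFstFst μ (θ + α * r) (φ + β * r)
        + β * γ.v (φ + β * r) * γ.twoPointFstSnd μ (θ + α * r) (φ + β * r)) r := by
  have x1 := hasDerivAt_comp_affine θ α r γ.hx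
  have y1 := hasDerivAt_comp_affine θ α r γ.hy
  have n1 := hasDerivAt_comp_affine θ α r γ.hn
  have m1 := hasDerivAt_comp_affine θ α r γ.hm
  have k1 := hasDerivAt_comp_affine θ α r γ.hκ
  have w1 := hasDerivAt_comp_affine θ α r γ.hw
  have x2 := hasDerivAt_comp_affine φ β r γ.hx
  have y2 := hasDerivAt_comp_affine φ β r γ.hy
  have u1 := x1.sub x2
  have u2 := y1.sub y2
  have := (((k1.sub (k1.const_mul μ)).const_mul 2).mul ((u1.neg.mul m1).add (u2.mul n1))).sub
    ((w1.const_mul μ).mul ((u1.pow 2).add (u2.pow 2)))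
  refine this.congr_deriv ?_
  have hu := γ.unit (θ + α * r)
  simp only [twoPointFstFst, twoPointFstSnd, chordTangent, chordNormal, chordSq, Pi.sub_apply,
    Pi.add_apply, Pi.pow_apply, Pi.mul_apply, Pi.neg_apply]
  push_cast
  linear_combination (2 * (γ.κ (θ + α * r) - μ * γ.κ (θ + α * r)) * α * γ.v (θ + α * r)) * hu

theorem hasDerivAt_twoPointSnd_path :
    HasDerivAt (fun r => γ.twoPointSnd μ (θ + α * r) (φ + β * r))
      (α * γ.v (θ + α * r) * γ.twoPointFstSnd μ (θ + α * r) (φ + β * r)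
        + β * γ.v (φ + β * r) * γ.twoPointSndSnd μ (θ + α * r) (φ + β * r)) r := by
  have x1 := hasDerivAt_comp_affine θ α r γ.hx
  have y1 := hasDerivAt_comp_affine θ α r γ.hy
  have n1 := hasDerivAt_comp_affine θ α r γ.hn
  have m1 := hasDerivAt_comp_affine θ α r γ.hm
  have k1 := hasDerivAt_comp_affine θ α r γ.hκ
  have x2 := hasDerivAt_comp_affine φ β r γ.hx
  have y2 := hasDerivAt_comp_affine φ β r γ.hy
  have n2 := hasDerivAt_comp_affine φ β r γ.hn
  have m2 := hasDerivAt_comp_affine φ β r γ.hm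
  have u1 := x1.sub x2
  have u2 := y1.sub y2
  have := (((m2.neg).mul (n1.sub ((k1.const_mul μ).mul u1))).add
    (n2.mul (m1.sub ((k1.const_mul μ).mul u2)))).const_mul (-2)
  refine this.congr_deriv ?_
  have hu := γ.unit (φ + β * r)
  simp only [twoPointFstSnd, twoPointSndSnd, Pi.sub_apply, Pi.mul_apply,
    Pi.neg_apply]
  linear_combination (-2 * (μ * γ.κ (θ + α * r)) * β * γ.v (φ + β * r)) * hu

end path

variable {γ μ} {θ φ : ℝ}

/-- A zero of a nonpositive function is a maximum along both coordinate lines, and the speed factors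
do not vanish. -/
theorem first_order (hle : ∀ θ φ, γ.twoPoint μ θ φ ≤ 0) (h0 : γ.twoPoint μ θ φ = 0) :
    γ.twoPointFst μ θ φ = 0 ∧ γ.twoPointSnd μ θ φ = 0 := by
  have hmax : ∀ α β : ℝ, IsLocalMax (fun r => γ.twoPoint μ (θ + α * r) (φ + β * r)) 0 :=
    fun α β => Eventually.of_forall fun r => by simpa [h0] using hle _ _
  have h1 := (hmax 1 0).hasDerivAt_eq_zero (γ.hasDerivAt_twoPoint_path μ θ φ 1 0 0)
  have h2 := (hmax 0 1).hasDerivAt_eq_zero (γ.hasDerivAt_twoPoint_path μ θ φ 0 1 0)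
  simp [γ.v_ne] at h1 h2
  exact ⟨h1, h2⟩

/-- The Hessian test in arclength directions: dividing the direction by the speeds normalizes it,
and the terms containing derivatives of the speed drop out by the first-order conditions. -/
theorem second_order (hle : ∀ θ φ, γ.twoPoint μ θ φ ≤ 0) (h0 : γ.twoPoint μ θ φ = 0) (a b : ℝ) :
    a ^ 2 * γ.twoPointFstFst μ θ φ + 2 * a * b * γ.twoPointFstSnd μ θ φ
      + b ^ 2 * γ.twoPointSndSnd μ θ φ ≤ 0 := by
  obtain ⟨e1, e2⟩ := first_order hle h0
  have v1 := γ.v_ne θ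
  have v2 := γ.v_ne φ
  set α := a / γ.v θ
  set β := b / γ.v φ
  have hα : α * γ.v θ = a := div_mul_cancel₀ _ v1
  have hβ : β * γ.v φ = b := div_mul_cancel₀ _ v2
  have hmax : IsLocalMax (fun r => γ.twoPoint μ (θ + α * r) (φ + β * r)) 0 :=
    Eventually.of_forall fun r => by simpa [h0] using hle _ _
  have V1 := (hasDerivAt_comp_affine θ α 0 (fun s => (γ.v_diff s).hasDerivAt)).const_mul α
  have V2 := (hasDerivAt_comp_affine φ β 0 (fun s => (γ.v_diff s).hasDerivAt)).const_mul β
  have hd₂ := (V1.mul (γ.hasDerivAt_twoPointFst_path μ θ φ α β 0)).add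
    (V2.mul (γ.hasDerivAt_twoPointSnd_path μ θ φ α β 0))
  have := second_deriv_nonpos_of_isLocalMax hmax
    (fun r => γ.hasDerivAt_twoPoint_path μ θ φ α β r) hd₂
  simp only [mul_zero, add_zero, e1, e2, hα, hβ, zero_add] at this
  linarith

/-- At an interior zero maximum of the two-point function, the touching disc has the normal
`ν(φ) = ν(θ) - μ κ(θ) (X(θ) - X(φ))` at the second point of contact. -/
theorem normal_eq_of_touching (hle : ∀ θ φ, γ.twoPoint μ θ φ ≤ 0) (h0 : γ.twoPoint μ θ φ = 0)
    (hμκ : 0 < μ * γ.κ θ) (hD : 0 < γ.chordSq θ φ)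
    (hconv : (γ.x θ - γ.x φ) * γ.n φ + (γ.y θ - γ.y φ) * γ.m φ ≤ 0) :
    γ.n φ = γ.n θ - μ * γ.κ θ * (γ.x θ - γ.x φ) ∧
      γ.m φ = γ.m θ - μ * γ.κ θ * (γ.y θ - γ.y φ) := by
  have e2 := (first_order hle h0).2
  have hu1 := γ.unit θ
  have hu2 := γ.unit φ
  simp only [twoPoint, chordNormal, chordSq, twoPointSnd] at *
  set u1 := γ.x θ - γ.x φ
  set u2 := γ.y θ - γ.y φ
  set k := μ * γ.κ θ
  set E1 := γ.n θ - k * u1 with hE1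
  set E2 := γ.m θ - k * u2 with hE2
  -- `(E1, E2)` is the outward normal of the touching disc at the second contact point; Z = 0 makes
  -- it a unit vector.
  have hE : E1 ^ 2 + E2 ^ 2 = 1 := by
    rw [hE1, hE2]; linear_combination hu1 - k * h0
  set l := E1 * γ.n φ + E2 * γ.m φ with hl
  have hcross : -γ.m φ * E1 + γ.n φ * E2 = 0 := by linarith
  have h1 : E1 = l * γ.n φ := by rw [hl]; linear_combination (-E1) * hu2 - γ.m φ * hcross
  have h2 : E2 = l * γ.m φ := by rw [hl]; linear_combination (-E2) * hu2 + γ.n φ * hcross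
  have hl2 : l ^ 2 = 1 := by
    rw [h1, h2] at hE; linear_combination hE - l ^ 2 * hu2
  -- First-order criticality only gives parallel normals. The chord pairs negatively with `(E1, E2)`
  -- and nonpositively with the curve normal by convexity, which excludes the opposite sign.
  have hneg : l * (u1 * γ.n φ + u2 * γ.m φ) < 0 := by
    have : l * (u1 * γ.n φ + u2 * γ.m φ) = u1 * E1 + u2 * E2 := by
      rw [h1, h2]; ring
    rw [this, hE1, hE2]
    linarith [mul_pos hμκ hD]
  have hl1 : l = 1 := by
    rcases mul_self_eq_one_iff.1 (sq l ▸ hl2) with h | h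
    · exact h
    · rw [h] at hneg; linarith
  rw [hl1, one_mul] at h1 h2
  exact ⟨h1.symm, h2.symm⟩

end FramedCurve

/-! ### Evolution equations of the normal, the speed and the curvature -/

section calculus

variable {T : ℝ} {F a b : ℝ × ℝ → ℝ} {c : ℝ}

theorem dθ_const_mul_mul (hF : ContDiffOn ℝ ∞ F (strip T)) (ha : ContDiffOn ℝ ∞ a (strip T))
    (hb : ContDiffOn ℝ ∞ b (strip T)) (h : ∀ q ∈ strip T, F q = c * (a q * b q)) {θ t : ℝ}
    (ht : t ∈ Ico 0 T) :
    dθ T F (θ, t) = c * (dθ T a (θ, t) * b (θ, t) + a (θ, t) * dθ T b (θ, t)) := by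
  refine dθ_eq_of_hasDerivAt hF ht ?_
  have e : (fun s => F (s, t)) = fun s => c * (a (s, t) * b (s, t)) :=
    funext fun s => h _ (mem_strip.2 ht)
  rw [e]
  exact ((hasDerivAt_dθ ha ht θ).mul (hasDerivAt_dθ hb ht θ)).const_mul c

theorem dt_const_mul_mul (hF : ContDiffOn ℝ ∞ F (strip T)) (ha : ContDiffOn ℝ ∞ a (strip T))
    (hb : ContDiffOn ℝ ∞ b (strip T)) (h : ∀ q ∈ strip T, F q = c * (a q * b q)) {θ t : ℝ}
    (ht : t ∈ Ico 0 T) :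
    dt T F (θ, t) = c * (dt T a (θ, t) * b (θ, t) + a (θ, t) * dt T b (θ, t)) := by
  refine dt_eq_of_hasDerivWithinAt hF ht ?_
  have := ((hasDerivWithinAt_dt ha ht θ).mul (hasDerivWithinAt_dt hb ht θ)).const_mul c
  exact this.congr (fun s hs => h _ (mem_strip.2 hs)) (h _ (mem_strip.2 ht))

end calculus

/-- A closed convex curve evolving by the power curvature flow, in coordinates: the curve is
`(x, y)`, its outward unit normal is `(n, m)`, `v` is the signed speed of the parametrization along
the rotated normal `(-m, n)`, `κ` is the curvature and `f = κ ^ p` the normal speed of the flow. -/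
structure FramedFlow (p T : ℝ) where
  (x y n m v κ f : ℝ × ℝ → ℝ)
  T_pos : 0 < T
  smooth_x : ContDiffOn ℝ ∞ x (strip T)
  smooth_y : ContDiffOn ℝ ∞ y (strip T)
  smooth_n : ContDiffOn ℝ ∞ n (strip T)
  smooth_m : ContDiffOn ℝ ∞ m (strip T)
  smooth_v : ContDiffOn ℝ ∞ v (strip T)
  smooth_κ : ContDiffOn ℝ ∞ κ (strip T)
  smooth_f : ContDiffOn ℝ ∞ f (strip T)
  unit : ∀ q ∈ strip T, n q ^ 2 + m q ^ 2 = 1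
  v_ne : ∀ q ∈ strip T, v q ≠ 0
  f_eq : ∀ q ∈ strip T, f q = κ q ^ p
  dθ_x : ∀ q ∈ strip T, dθ T x q = -1 * (v q * m q)
  dθ_y : ∀ q ∈ strip T, dθ T y q = 1 * (v q * n q)
  dθ_n : ∀ q ∈ strip T, dθ T n q = -1 * ((κ q * v q) * m q)
  dθ_m : ∀ q ∈ strip T, dθ T m q = 1 * ((κ q * v q) * n q)
  dt_x : ∀ q ∈ strip T, dt T x q = -1 * (f q * n q)
  dt_y : ∀ q ∈ strip T, dt T y q = -1 * (f q * m q)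
  convex : ∀ t ∈ Ico 0 T, ∀ θ φ,
    (x (φ, t) - x (θ, t)) * n (θ, t) + (y (φ, t) - y (θ, t)) * m (θ, t) ≤ 0
  exists_strict : ∀ t ∈ Ico 0 T, ∀ θ, ∃ φ,
    (x (φ, t) - x (θ, t)) * n (θ, t) + (y (φ, t) - y (θ, t)) * m (θ, t) < 0
  periodic : ∀ t ∈ Ico 0 T, ∀ θ (k : ℤ),
    x (θ + k * (2 * Real.pi), t) = x (θ, t) ∧ y (θ + k * (2 * Real.pi), t) = y (θ, t) ∧
    n (θ + k * (2 * Real.pi), t) = n (θ, t) ∧ m (θ + k * (2 * Real.pi), t) = m (θ, t) ∧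
    κ (θ + k * (2 * Real.pi), t) = κ (θ, t)
  injective : ∀ t ∈ Ico 0 T, ∀ θ φ, x (θ, t) = x (φ, t) → y (θ, t) = y (φ, t) →
    ∃ k : ℤ, φ = θ + k * (2 * Real.pi)

namespace FramedFlow

variable {p T : ℝ} (Φ : FramedFlow p T)

/-- The rotation speed of the normal under the flow. -/
def g (q : ℝ × ℝ) : ℝ := Φ.n q * dt T Φ.m q - Φ.m q * dt T Φ.n q

theorem smooth_g : ContDiffOn ℝ ∞ Φ.g (strip T) :=
  (Φ.smooth_n.mul (contDiffOn_dt Φ.smooth_m)).sub (Φ.smooth_m.mul (contDiffOn_dt Φ.smooth_n))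

/-- The arclength derivative of the curvature. -/
def w (q : ℝ × ℝ) : ℝ := dθ T Φ.κ q / Φ.v q

theorem smooth_w : ContDiffOn ℝ ∞ Φ.w (strip T) :=
  (contDiffOn_dθ Φ.smooth_κ).div Φ.smooth_v Φ.v_ne

/-- The second arclength derivative of the curvature. -/
def w' (q : ℝ × ℝ) : ℝ := dθ T Φ.w q / Φ.v q

/-- Since |ν| = 1, the time derivative of ν is tangential. -/
theorem dt_normal {q : ℝ × ℝ} (hq : q ∈ strip T) :
    dt T Φ.n q = -1 * (Φ.g q * Φ.m q) ∧ dt T Φ.m q = 1 * (Φ.g q * Φ.n q) := by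
  obtain ⟨θ, t⟩ := q
  have ht := mem_strip.1 hq
  have h1 := ((hasDerivWithinAt_dt Φ.smooth_n ht θ).pow 2).add
    ((hasDerivWithinAt_dt Φ.smooth_m ht θ).pow 2)
  have h2 : HasDerivWithinAt (fun _ : ℝ => (1 : ℝ)) _ (Ico 0 T) t :=
    h1.congr (fun s hs => (Φ.unit _ (mem_strip.2 hs)).symm) (Φ.unit _ hq).symm
  have h3 := (uniqueDiffOn_Ico 0 T t ht).eq_deriv _ h2 (hasDerivWithinAt_const t _ 1)
  have hu := Φ.unit _ hq
  simp only [Nat.cast_ofNat, Nat.add_one_sub_one, pow_one] at h3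
  unfold g
  constructor
  · linear_combination (-dt T Φ.n (θ, t)) * hu + Φ.n (θ, t) / 2 * h3
  · linear_combination (-dt T Φ.m (θ, t)) * hu + Φ.m (θ, t) / 2 * h3

/-- The rotation speed of the normal is the arclength derivative of the normal speed, and the
parametrization contracts at the rate `f κ`. -/
theorem dθ_f_and_dt_v {q : ℝ × ℝ} (hq : q ∈ strip T) :
    dθ T Φ.f q = Φ.v q * Φ.g q ∧ dt T Φ.v q = -(Φ.f q * Φ.κ q * Φ.v q) := by
  obtain ⟨θ, t⟩ := q
  have ht := mem_strip.1 hq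
  -- The two relations are the normal and tangential components of ∂θ∂ₜX = ∂ₜ∂θX.
  have hx := dθ_dt_comm Φ.T_pos Φ.smooth_x hq
  have hy := dθ_dt_comm Φ.T_pos Φ.smooth_y hq
  rw [dθ_const_mul_mul (contDiffOn_dt Φ.smooth_x) Φ.smooth_f Φ.smooth_n Φ.dt_x ht,
    dt_const_mul_mul (contDiffOn_dθ Φ.smooth_x) Φ.smooth_v Φ.smooth_m Φ.dθ_x ht,
    (Φ.dt_normal hq).2, Φ.dθ_n _ hq] at hx
  rw [dθ_const_mul_mul (contDiffOn_dt Φ.smooth_y) Φ.smooth_f Φ.smooth_m Φ.dt_y ht,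
    dt_const_mul_mul (contDiffOn_dθ Φ.smooth_y) Φ.smooth_v Φ.smooth_n Φ.dθ_y ht,
    (Φ.dt_normal hq).1, Φ.dθ_m _ hq] at hy
  have hu := Φ.unit _ hq
  constructor
  · linear_combination (-Φ.n (θ, t)) * hx - Φ.m (θ, t) * hy
      + (Φ.v (θ, t) * Φ.g (θ, t) - dθ T Φ.f (θ, t)) * hu
  · linear_combination Φ.m (θ, t) * hx - Φ.n (θ, t) * hy
      - (dt T Φ.v (θ, t) + Φ.f (θ, t) * Φ.κ (θ, t) * Φ.v (θ, t)) * hu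

/-- The evolution equation of the curvature, `∂ₜκ = ∂ₛ²f + κ² f`. -/
theorem dt_κ {q : ℝ × ℝ} (hq : q ∈ strip T) :
    dt T Φ.κ q = dθ T Φ.g q / Φ.v q + Φ.κ q ^ 2 * Φ.f q := by
  obtain ⟨θ, t⟩ := q
  have ht := mem_strip.1 hq
  -- The tangential component of ∂θ∂ₜν = ∂ₜ∂θν reads ∂ₜ(κv) = ∂θg.
  have hn := dθ_dt_comm Φ.T_pos Φ.smooth_n hq
  have hm := dθ_dt_comm Φ.T_pos Φ.smooth_m hq
  have hK : ContDiffOn ℝ ∞ (fun q => Φ.κ q * Φ.v q) (strip T) := Φ.smooth_κ.mul Φ.smooth_v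
  rw [dθ_const_mul_mul (contDiffOn_dt Φ.smooth_n) Φ.smooth_g Φ.smooth_m
      (fun q hq => (Φ.dt_normal hq).1) ht,
    dt_const_mul_mul (contDiffOn_dθ Φ.smooth_n) hK Φ.smooth_m Φ.dθ_n ht,
    (Φ.dt_normal hq).2, Φ.dθ_m _ hq] at hn
  rw [dθ_const_mul_mul (contDiffOn_dt Φ.smooth_m) Φ.smooth_g Φ.smooth_n
      (fun q hq => (Φ.dt_normal hq).2) ht,
    dt_const_mul_mul (contDiffOn_dθ Φ.smooth_m) hK Φ.smooth_n Φ.dθ_m ht,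
    (Φ.dt_normal hq).1, Φ.dθ_n _ hq] at hm
  have hKt := dt_const_mul_mul (c := 1) (θ := θ) hK Φ.smooth_κ Φ.smooth_v
    (fun q _ => (one_mul _).symm) ht
  rw [(Φ.dθ_f_and_dt_v hq).2] at hKt
  have hu := Φ.unit _ hq
  have hv := Φ.v_ne _ hq
  have h1 : dt T (fun q => Φ.κ q * Φ.v q) (θ, t) = dθ T Φ.g (θ, t) := by
    linear_combination Φ.m (θ, t) * hn - Φ.n (θ, t) * hm
      - (dt T (fun q => Φ.κ q * Φ.v q) (θ, t) - dθ T Φ.g (θ, t)) * hu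
  rw [← h1, hKt]
  field_simp
  ring

/-- The curve at a fixed time. -/
@[simps]
def slice {t : ℝ} (ht : t ∈ Ico 0 T) : FramedCurve where
  x θ := Φ.x (θ, t)
  y θ := Φ.y (θ, t)
  n θ := Φ.n (θ, t)
  m θ := Φ.m (θ, t)
  v θ := Φ.v (θ, t)
  κ θ := Φ.κ (θ, t)
  w θ := Φ.w (θ, t)
  w' θ := Φ.w' (θ, t)
  unit θ := Φ.unit _ (mem_strip.2 ht)
  v_ne θ := Φ.v_ne _ (mem_strip.2 ht)
  v_diff θ := (hasDerivAt_dθ Φ.smooth_v ht θ).differentiableAt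
  hx θ := by simpa [Φ.dθ_x _ (mem_strip.2 ht)] using hasDerivAt_dθ Φ.smooth_x ht θ
  hy θ := by simpa [Φ.dθ_y _ (mem_strip.2 ht)] using hasDerivAt_dθ Φ.smooth_y ht θ
  hn θ := by simpa [Φ.dθ_n _ (mem_strip.2 ht)] using hasDerivAt_dθ Φ.smooth_n ht θ
  hm θ := by simpa [Φ.dθ_m _ (mem_strip.2 ht)] using hasDerivAt_dθ Φ.smooth_m ht θ
  hκ θ := by
    have := Φ.v_ne _ (mem_strip.2 ht : (θ, t) ∈ strip T)
    simpa [w, mul_div_cancel₀ _ this] using hasDerivAt_dθ Φ.smooth_κ ht θ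
  hw θ := by
    have := Φ.v_ne _ (mem_strip.2 ht : (θ, t) ∈ strip T)
    simpa [w', mul_div_cancel₀ _ this] using hasDerivAt_dθ Φ.smooth_w ht θ

/-- At a time of positive curvature, the arclength derivatives of the speed `f = κ ^ p`. -/
theorem speed_derivatives {t : ℝ} (ht : t ∈ Ico 0 T) (hκ : ∀ θ, 0 < Φ.κ (θ, t)) (θ : ℝ) :
    Φ.g (θ, t) = p * Φ.κ (θ, t) ^ (p - 1) * Φ.w (θ, t) ∧
    dθ T Φ.g (θ, t) / Φ.v (θ, t) = p * Φ.κ (θ, t) ^ (p - 1) * Φ.w' (θ, t)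
      + p * (p - 1) * Φ.κ (θ, t) ^ (p - 2) * Φ.w (θ, t) ^ 2 := by
  have hg : ∀ θ, Φ.g (θ, t) = p * Φ.κ (θ, t) ^ (p - 1) * Φ.w (θ, t) := by
    intro θ
    have hq : (θ, t) ∈ strip T := mem_strip.2 ht
    have hv := Φ.v_ne _ hq
    have h1 : dθ T Φ.f (θ, t) = dθ T Φ.κ (θ, t) * p * Φ.κ (θ, t) ^ (p - 1) := by
      refine dθ_eq_of_hasDerivAt Φ.smooth_f ht ?_
      have e : (fun s => Φ.f (s, t)) = fun s => Φ.κ (s, t) ^ p :=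
        funext fun s => Φ.f_eq _ (mem_strip.2 ht)
      rw [e]
      exact (hasDerivAt_dθ Φ.smooth_κ ht θ).rpow_const (Or.inl (hκ θ).ne')
    rw [(Φ.dθ_f_and_dt_v hq).1] at h1
    rw [w, mul_div_assoc', eq_div_iff hv]
    linarith
  refine ⟨hg θ, ?_⟩
  have hv := Φ.v_ne _ (mem_strip.2 ht : (θ, t) ∈ strip T)
  have hw := (Φ.slice ht).hw θ
  have hk := (Φ.slice ht).hκ θ
  simp only [slice_w, slice_v, slice_w'] at hw hk
  rw [div_eq_iff hv]
  refine dθ_eq_of_hasDerivAt Φ.smooth_g ht ?_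
  rw [funext hg]
  refine (((hk.rpow_const (p := p - 1) (Or.inl (hκ θ).ne')).const_mul p).mul hw).congr_deriv ?_
  rw [show p - 1 - 1 = p - 2 by ring]
  simp only [slice_w, slice_κ]
  ring

end FramedFlow

/-! ### Time derivative of the two-point function at an off-diagonal zero -/

namespace FramedFlow

variable {p T : ℝ} (Φ : FramedFlow p T) (μ : ℝ)

/-- The two-point function of the curve at time `t`. -/
def twoPoint (θ φ t : ℝ) : ℝ :=
  2 * ((Φ.x (θ, t) - Φ.x (φ, t)) * Φ.n (θ, t) + (Φ.y (θ, t) - Φ.y (φ, t)) * Φ.m (θ, t))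
    - μ * Φ.κ (θ, t) * ((Φ.x (θ, t) - Φ.x (φ, t)) ^ 2 + (Φ.y (θ, t) - Φ.y (φ, t)) ^ 2)

/-- The time derivative of the two-point function. -/
def twoPointDt (θ φ t : ℝ) : ℝ :=
  2 * (((dt T Φ.x (θ, t) - dt T Φ.x (φ, t)) * Φ.n (θ, t)
      + (Φ.x (θ, t) - Φ.x (φ, t)) * dt T Φ.n (θ, t))
    + ((dt T Φ.y (θ, t) - dt T Φ.y (φ, t)) * Φ.m (θ, t)
      + (Φ.y (θ, t) - Φ.y (φ, t)) * dt T Φ.m (θ, t)))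
  - (μ * dt T Φ.κ (θ, t) * ((Φ.x (θ, t) - Φ.x (φ, t)) ^ 2 + (Φ.y (θ, t) - Φ.y (φ, t)) ^ 2)
    + μ * Φ.κ (θ, t) * (2 * (Φ.x (θ, t) - Φ.x (φ, t)) * (dt T Φ.x (θ, t) - dt T Φ.x (φ, t))
      + 2 * (Φ.y (θ, t) - Φ.y (φ, t)) * (dt T Φ.y (θ, t) - dt T Φ.y (φ, t))))

theorem twoPoint_eq {t : ℝ} (ht : t ∈ Ico 0 T) (θ φ : ℝ) :
    Φ.twoPoint μ θ φ t = (Φ.slice ht).twoPoint μ θ φ := rfl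

theorem hasDerivWithinAt_twoPoint {t : ℝ} (ht : t ∈ Ico 0 T) (θ φ : ℝ) :
    HasDerivWithinAt (Φ.twoPoint μ θ φ) (Φ.twoPointDt μ θ φ t) (Ico 0 T) t := by
  have u1 := (hasDerivWithinAt_dt Φ.smooth_x ht θ).sub (hasDerivWithinAt_dt Φ.smooth_x ht φ)
  have u2 := (hasDerivWithinAt_dt Φ.smooth_y ht θ).sub (hasDerivWithinAt_dt Φ.smooth_y ht φ)
  have := (((u1.mul (hasDerivWithinAt_dt Φ.smooth_n ht θ)).add
    (u2.mul (hasDerivWithinAt_dt Φ.smooth_m ht θ))).const_mul 2).sub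
    (((hasDerivWithinAt_dt Φ.smooth_κ ht θ).const_mul μ).mul ((u1.pow 2).add (u2.pow 2)))
  refine this.congr_deriv ?_
  simp only [twoPointDt, Pi.sub_apply, Pi.add_apply, Pi.pow_apply]
  push_cast
  ring

theorem continuousOn_fst {F : ℝ × ℝ → ℝ} (hF : ContDiffOn ℝ ∞ F (strip T)) :
    ContinuousOn (fun z : ℝ × ℝ × ℝ => F (z.1, z.2.2)) (univ ×ˢ univ ×ˢ Ico 0 T) :=
  hF.continuousOn.comp (by fun_prop) fun _ hz => mem_strip.2 hz.2.2

theorem continuousOn_snd {F : ℝ × ℝ → ℝ} (hF : ContDiffOn ℝ ∞ F (strip T)) :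
    ContinuousOn (fun z : ℝ × ℝ × ℝ => F (z.2.1, z.2.2)) (univ ×ˢ univ ×ˢ Ico 0 T) :=
  hF.continuousOn.comp (by fun_prop) fun _ hz => mem_strip.2 hz.2.2

theorem continuousOn_twoPoint :
    ContinuousOn (fun z : ℝ × ℝ × ℝ => Φ.twoPoint μ z.1 z.2.1 z.2.2)
      (univ ×ˢ univ ×ˢ Ico 0 T) := by
  have x1 := continuousOn_fst Φ.smooth_x
  have y1 := continuousOn_fst Φ.smooth_y
  have n1 := continuousOn_fst Φ.smooth_n
  have m1 := continuousOn_fst Φ.smooth_m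
  have k1 := continuousOn_fst Φ.smooth_κ
  have x2 := continuousOn_snd Φ.smooth_x
  have y2 := continuousOn_snd Φ.smooth_y
  unfold twoPoint
  fun_prop

theorem continuousOn_twoPointDt :
    ContinuousOn (fun z : ℝ × ℝ × ℝ => Φ.twoPointDt μ z.1 z.2.1 z.2.2)
      (univ ×ˢ univ ×ˢ Ico 0 T) := by
  have x1 := continuousOn_fst Φ.smooth_x
  have y1 := continuousOn_fst Φ.smooth_y
  have n1 := continuousOn_fst Φ.smooth_n
  have m1 := continuousOn_fst Φ.smooth_m
  have k1 := continuousOn_fst Φ.smooth_κ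
  have x2 := continuousOn_snd Φ.smooth_x
  have y2 := continuousOn_snd Φ.smooth_y
  have x1' := continuousOn_fst (contDiffOn_dt Φ.smooth_x)
  have y1' := continuousOn_fst (contDiffOn_dt Φ.smooth_y)
  have n1' := continuousOn_fst (contDiffOn_dt Φ.smooth_n)
  have m1' := continuousOn_fst (contDiffOn_dt Φ.smooth_m)
  have k1' := continuousOn_fst (contDiffOn_dt Φ.smooth_κ)
  have x2' := continuousOn_snd (contDiffOn_dt Φ.smooth_x)
  have y2' := continuousOn_snd (contDiffOn_dt Φ.smooth_y)
  unfold twoPointDt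
  fun_prop

theorem continuousOn_twoPointSndSnd :
    ContinuousOn (fun z : ℝ × ℝ × ℝ =>
      2 * Φ.κ (z.2.1, z.2.2) * (Φ.n (z.2.1, z.2.2) * (Φ.n (z.1, z.2.2)
        - μ * Φ.κ (z.1, z.2.2) * (Φ.x (z.1, z.2.2) - Φ.x (z.2.1, z.2.2)))
      + Φ.m (z.2.1, z.2.2) * (Φ.m (z.1, z.2.2)
        - μ * Φ.κ (z.1, z.2.2) * (Φ.y (z.1, z.2.2) - Φ.y (z.2.1, z.2.2))))
      - 2 * μ * Φ.κ (z.1, z.2.2)) (univ ×ˢ univ ×ˢ Ico 0 T) := by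
  have x1 := continuousOn_fst Φ.smooth_x
  have y1 := continuousOn_fst Φ.smooth_y
  have n1 := continuousOn_fst Φ.smooth_n
  have m1 := continuousOn_fst Φ.smooth_m
  have k1 := continuousOn_fst Φ.smooth_κ
  have x2 := continuousOn_snd Φ.smooth_x
  have y2 := continuousOn_snd Φ.smooth_y
  have n2 := continuousOn_snd Φ.smooth_n
  have m2 := continuousOn_snd Φ.smooth_m
  have k2 := continuousOn_snd Φ.smooth_κ
  fun_prop

/-- If κ(θ) ≤ 0, the quadratic term of Z is nonnegative, and a curve point strictly inside the
tangent line at θ makes Z positive. -/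
theorem curvature_pos {μ : ℝ} (hμ : 0 < μ) {t : ℝ} (ht : t ∈ Ico 0 T)
    (hle : ∀ θ φ, Φ.twoPoint μ θ φ t ≤ 0) (θ : ℝ) : 0 < Φ.κ (θ, t) := by
  obtain ⟨φ, hφ⟩ := Φ.exists_strict t ht θ
  have h := hle θ φ
  unfold twoPoint at h
  by_contra! hk
  have : 0 ≤ -(μ * Φ.κ (θ, t)) * ((Φ.x (θ, t) - Φ.x (φ, t)) ^ 2 + (Φ.y (θ, t) - Φ.y (φ, t)) ^ 2) :=
    mul_nonneg (by linarith [mul_nonneg hμ.le (neg_nonneg.2 hk)]) (by positivity)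
  linarith

variable {μ}

/-- The time derivative of the two-point function is negative where it has an off-diagonal
spatial maximum with value zero. -/
theorem twoPointDt_neg (hp : 1 < p) (hμ : 1 < μ)
    (hpinch : μ ^ p - 1 + (μ - 1) * (p - 2 * (p - 1) / μ - 2 * √p) < 0) {t : ℝ}
    (ht : t ∈ Ico 0 T) (hle : ∀ θ φ, Φ.twoPoint μ θ φ t ≤ 0) {θ φ : ℝ}
    (h0 : Φ.twoPoint μ θ φ t = 0)
    (hD : 0 < (Φ.x (θ, t) - Φ.x (φ, t)) ^ 2 + (Φ.y (θ, t) - Φ.y (φ, t)) ^ 2) :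
    Φ.twoPointDt μ θ φ t < 0 := by
  have hμ0 : 0 < μ := by linarith
  have hκ := Φ.curvature_pos hμ0 ht hle
  have hq : (θ, t) ∈ strip T := mem_strip.2 ht
  have hq' : (φ, t) ∈ strip T := mem_strip.2 ht
  have hk : 0 < μ * Φ.κ (θ, t) := mul_pos hμ0 (hκ θ)
  have hF := FramedCurve.first_order (γ := Φ.slice ht) hle h0
  have hS := FramedCurve.second_order (γ := Φ.slice ht) hle h0
  have hN := FramedCurve.normal_eq_of_touching (γ := Φ.slice ht) hle h0 hk hD (Φ.convex t ht φ θ)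
  have e1 := hF.1
  have e2 := hF.2
  -- The pure second-variable direction will give κ(φ) ≤ μκ(θ); the direction (1, -1/√p) carries the
  -- main estimate.
  have hSnd := hS 0 1
  have hc := hS 1 (-1 / √p)
  have hsp := Φ.speed_derivatives ht hκ θ
  have hu := Φ.unit _ hq
  have hu' := Φ.unit _ hq'
  unfold twoPoint at h0
  obtain ⟨N1, N2⟩ := hN
  simp only [FramedCurve.twoPointFst, FramedCurve.twoPointSnd, FramedCurve.twoPointFstFst,
    FramedCurve.twoPointFstSnd, FramedCurve.twoPointSndSnd, FramedCurve.chordTangent,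
    FramedCurve.chordNormal, FramedCurve.chordSq, slice_x, slice_y, slice_n, slice_m, slice_κ,
    slice_w, slice_w'] at e1 e2 hSnd hc N1 N2
  have key := time_derivative_neg (p := p) (μ := μ) (κ := Φ.κ (θ, t)) (q := Φ.κ (φ, t))
    (D := (Φ.x (θ, t) - Φ.x (φ, t)) ^ 2 + (Φ.y (θ, t) - Φ.y (φ, t)) ^ 2)
    (a := -(Φ.x (θ, t) - Φ.x (φ, t)) * Φ.m (θ, t) + (Φ.y (θ, t) - Φ.y (φ, t)) * Φ.n (θ, t))
    (w := Φ.w (θ, t)) (w' := Φ.w' (θ, t)) hp hμ hpinch (hκ θ) (hκ φ).le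
  unfold twoPointDt
  rw [Φ.dt_x _ hq, Φ.dt_x _ hq', Φ.dt_y _ hq, Φ.dt_y _ hq', (Φ.dt_normal hq).1,
    (Φ.dt_normal hq).2, Φ.dt_κ hq, hsp.2, hsp.1, Φ.f_eq _ hq, Φ.f_eq _ hq']
  rw [← N1, ← N2] at hSnd hc
  generalize Φ.κ (θ, t) ^ p = f1 at *
  generalize Φ.κ (φ, t) ^ p = f2 at *
  generalize Φ.κ (θ, t) ^ (p - 1) = A at *
  generalize Φ.κ (θ, t) ^ (p - 2) = B at *
  generalize Φ.κ (θ, t) = κ at *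
  generalize Φ.κ (φ, t) = q at *
  generalize Φ.w (θ, t) = w at *
  generalize Φ.w' (θ, t) = w' at *
  generalize Φ.n (θ, t) = n at *
  generalize Φ.m (θ, t) = m at *
  generalize Φ.n (φ, t) = n' at *
  generalize Φ.m (φ, t) = m' at *
  generalize Φ.x (θ, t) - Φ.x (φ, t) = u at *
  generalize Φ.y (θ, t) - Φ.y (φ, t) = z at *
  generalize -1 / √p = c at *
  clear hF hS hsp hpinch hle hκ
  have ha : (-u * m + z * n) ^ 2 = u ^ 2 + z ^ 2 - (μ * κ * (u ^ 2 + z ^ 2) / 2) ^ 2 := by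
    linear_combination (u ^ 2 + z ^ 2) * hu
      - (u * n + z * m + μ * κ * (u ^ 2 + z ^ 2) / 2) / 2 * h0
  have hwa : μ * w * (-u * m + z * n)
      = 2 * (κ - μ * κ) * (1 - (μ * κ) ^ 2 * (u ^ 2 + z ^ 2) / 4) := by
    refine mul_left_cancel₀ hD.ne' ?_
    linear_combination (-(-u * m + z * n)) * e1 + 2 * (κ - μ * κ) * ha
  -- The equality of ν(φ) with the disc normal, together with the first-order condition in θ,
  -- determines the mixed derivative.
  have hmix : -2 * (κ - μ * κ) * (m * m' + n * n') + 2 * μ * w * (-u * m' + z * n')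
      = -2 * (μ * κ - κ) := by
    rw [N1, N2]
    linear_combination 2 * hwa - 2 * (κ - μ * κ) * hu + (κ - μ * κ) * (μ * κ) * h0
  have key' := key (by linear_combination (1 / 2) * hSnd - q * hu') hD ha
    (by linear_combination -e1)
    (by linear_combination hc - 2 * c * hmix - 2 * c ^ 2 * q * hu'
          + (κ - μ * κ) * κ * h0)
  linear_combination key' - 2 * f2 * n' * N1 - 2 * f2 * m' * N2 + 2 * f2 * hu' - 2 * f1 * hu
    + f1 * μ * κ * h0

end FramedFlow

/-! ### Control near the diagonal -/

/-- The mean value theorem between two points in any order. -/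
theorem exists_mem_uIcc_sub_eq {h h' : ℝ → ℝ} (hd : ∀ r, HasDerivAt h (h' r) r) (a b : ℝ) :
    ∃ ξ ∈ uIcc a b, h b - h a = h' ξ * (b - a) := by
  have hc : Continuous h := continuous_iff_continuousAt.2 fun r => (hd r).continuousAt
  rcases lt_trichotomy a b with hab | hab | hab
  · obtain ⟨ξ, hξ, e⟩ := exists_hasDerivAt_eq_slope h h' hab hc.continuousOn fun r _ => hd r
    refine ⟨ξ, Icc_subset_uIcc (Ioo_subset_Icc_self hξ), ?_⟩
    rw [e, div_mul_cancel₀ _ (sub_ne_zero.2 hab.ne')]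
  · exact ⟨a, left_mem_uIcc, by simp [hab]⟩
  · obtain ⟨ξ, hξ, e⟩ := exists_hasDerivAt_eq_slope h h' hab hc.continuousOn fun r _ => hd r
    refine ⟨ξ, Icc_subset_uIcc' (Ioo_subset_Icc_self hξ), ?_⟩
    rw [e, ← neg_sub a b, mul_neg, div_mul_cancel₀ _ (sub_ne_zero.2 hab.ne')]
    ring

namespace FramedCurve

theorem v_mul_pos (γ : FramedCurve) (a b : ℝ) : 0 < γ.v a * γ.v b := by
  by_contra! h
  have hc : ContinuousOn γ.v (uIcc a b) := fun r _ => (γ.v_diff r).continuousAt.continuousWithinAt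
  have : (0 : ℝ) ∈ uIcc (γ.v a) (γ.v b) := by
    rw [mem_uIcc]
    rcases lt_or_gt_of_ne (γ.v_ne a) with ha | ha
    · exact Or.inl ⟨ha.le, by by_contra! hb; linarith [mul_pos_of_neg_of_neg ha hb]⟩
    · exact Or.inr ⟨by by_contra! hb; linarith [mul_pos ha hb], ha.le⟩
  obtain ⟨r, _, hr⟩ := intermediate_value_uIcc hc this
  exact γ.v_ne r hr

/-- Near the diagonal the two-point function is nonpositive if its second derivative is. -/
theorem twoPoint_nonpos_of_sndSnd_nonpos (γ : FramedCurve) {μ θ φ : ℝ}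
    (h : ∀ ξ ∈ uIcc θ φ, γ.twoPointSndSnd μ θ ξ ≤ 0) : γ.twoPoint μ θ φ ≤ 0 := by
  have d1 : ∀ r, HasDerivAt (γ.twoPoint μ θ) (γ.v r * γ.twoPointSnd μ θ r) r := fun r => by
    simpa using γ.hasDerivAt_twoPoint_path μ θ 0 0 1 r
  have d2 : ∀ r, HasDerivAt (γ.twoPointSnd μ θ) (γ.v r * γ.twoPointSndSnd μ θ r) r := fun r => by
    simpa using γ.hasDerivAt_twoPointSnd_path μ θ 0 0 1 r
  -- Z and its φ-derivative both vanish on the diagonal, so two mean value steps express Z as a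
  -- nonnegative factor times a second derivative; the two speeds that occur have the same sign.
  obtain ⟨η, hη, e1⟩ := exists_mem_uIcc_sub_eq d1 θ φ
  obtain ⟨ξ, hξ, e2⟩ := exists_mem_uIcc_sub_eq d2 θ η
  have z1 : γ.twoPoint μ θ θ = 0 := by simp [twoPoint, chordNormal, chordSq]
  have z2 : γ.twoPointSnd μ θ θ = 0 := by simp [twoPointSnd]; ring
  rw [z1, sub_zero] at e1
  rw [z2, sub_zero] at e2
  have hs : 0 ≤ (η - θ) * (φ - θ) := by
    rcases mem_uIcc.1 hη with h' | h'
    · exact mul_nonneg (by linarith) (by linarith)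
    · exact mul_nonneg_of_nonpos_of_nonpos (by linarith) (by linarith)
  have hξ' := h ξ (uIcc_subset_uIcc_left hη hξ)
  rw [e1, e2]
  have := mul_nonneg (mul_nonneg (γ.v_mul_pos η ξ).le hs) (neg_nonneg.2 hξ')
  linarith

end FramedCurve

/-- A continuous function on space-time stays negative near a point where it is negative. -/
theorem exists_box_neg {T : ℝ} {G : ℝ × ℝ × ℝ → ℝ} (hG : ContinuousOn G (univ ×ˢ univ ×ˢ Ico 0 T))
    {θ φ t : ℝ} (ht : t ∈ Ico 0 T) (h : G (θ, φ, t) < 0) :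
    ∃ ε > 0, ∀ θ' φ' t', |θ' - θ| < ε → |φ' - φ| < ε → |t' - t| < ε → t' ∈ Ico 0 T →
      G (θ', φ', t') < 0 := by
  have h1 := (hG (θ, φ, t) (by simpa using ht)).eventually_lt_const h
  obtain ⟨ε, hε, hsub⟩ := Metric.mem_nhdsWithin_iff.1 h1
  refine ⟨ε, hε, fun θ' φ' t' h1 h2 h3 h4 => hsub ⟨?_, by simpa using h4⟩⟩
  simp only [Metric.mem_ball, Prod.dist_eq, max_lt_iff, Real.dist_eq]
  exact ⟨h1, h2, h3⟩

/-! ### Continuation in time -/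

namespace FramedFlow

variable {p T : ℝ} (Φ : FramedFlow p T) {μ : ℝ}

theorem twoPoint_add_period {t : ℝ} (ht : t ∈ Ico 0 T) (θ φ : ℝ) (j k : ℤ) :
    Φ.twoPoint μ (θ + j * (2 * Real.pi)) (φ + k * (2 * Real.pi)) t = Φ.twoPoint μ θ φ t := by
  obtain ⟨a1, a2, a3, a4, a5⟩ := Φ.periodic t ht θ j
  obtain ⟨b1, b2, b3, b4, b5⟩ := Φ.periodic t ht φ k
  simp only [twoPoint, a1, a2, a3, a4, a5, b1, b2]

theorem twoPoint_box_of_neg {t θ φ : ℝ} (ht : t ∈ Ico 0 T) (h : Φ.twoPoint μ θ φ t < 0) :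
    ∃ ε > 0, ∀ θ' φ' t', |θ' - θ| < ε → |φ' - φ| < ε → |t' - t| < ε → t' ∈ Ico t T →
      Φ.twoPoint μ θ' φ' t' ≤ 0 := by
  obtain ⟨ε, hε, H⟩ := exists_box_neg (Φ.continuousOn_twoPoint μ) ht h
  exact ⟨ε, hε, fun θ' φ' t' h1 h2 h3 h4 =>
    (H θ' φ' t' h1 h2 h3 ⟨ht.1.trans h4.1, h4.2⟩).le⟩

/-- The time derivative stays negative on a whole space-time box, so Z decreases there from its
nonpositive values at time t. -/
theorem twoPoint_box_of_dt_neg {t θ φ : ℝ} (ht : t ∈ Ico 0 T)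
    (hle : ∀ θ φ, Φ.twoPoint μ θ φ t ≤ 0) (h : Φ.twoPointDt μ θ φ t < 0) :
    ∃ ε > 0, ∀ θ' φ' t', |θ' - θ| < ε → |φ' - φ| < ε → |t' - t| < ε → t' ∈ Ico t T →
      Φ.twoPoint μ θ' φ' t' ≤ 0 := by
  obtain ⟨ε, hε, H⟩ := exists_box_neg (Φ.continuousOn_twoPointDt μ) ht h
  refine ⟨ε, hε, fun θ' φ' t' h1 h2 h3 h4 => ?_⟩
  have hsub : Icc t t' ⊆ Ico 0 T := fun s hs => ⟨ht.1.trans hs.1, hs.2.trans_lt h4.2⟩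
  have hanti : AntitoneOn (Φ.twoPoint μ θ' φ') (Icc t t') := by
    refine antitoneOn_of_hasDerivWithinAt_nonpos (f' := Φ.twoPointDt μ θ' φ') (convex_Icc t t')
      (fun s hs => (Φ.hasDerivWithinAt_twoPoint μ (hsub hs) θ' φ').continuousWithinAt.mono hsub)
      (fun s hs => (Φ.hasDerivWithinAt_twoPoint μ (hsub (interior_subset hs)) θ' φ').mono
        (interior_subset.trans hsub)) (fun s hs => ?_)
    have hs' := interior_subset hs
    refine (H θ' φ' s h1 h2 ?_ (hsub hs')).le
    rw [abs_of_nonneg (by linarith [hs'.1])]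
    rw [abs_of_nonneg (by linarith [h4.1])] at h3
    linarith [hs'.2]
  exact (hanti ⟨le_rfl, h4.1⟩ ⟨h4.1, le_rfl⟩ h4.1).trans (hle θ' φ')

/-- On the diagonal the second derivative in φ equals 2κ(1 - μ) < 0, and this persists nearby. The
shift by k periods accounts for distinct parameters of the same point. -/
theorem twoPoint_box_diagonal (hμ : 1 < μ) {t θ : ℝ} (k : ℤ) (ht : t ∈ Ico 0 T)
    (hκ : 0 < Φ.κ (θ, t)) :
    ∃ ε > 0, ∀ θ' φ' t', |θ' - θ| < ε → |φ' - (θ + k * (2 * Real.pi))| < ε → |t' - t| < ε →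
      t' ∈ Ico t T → Φ.twoPoint μ θ' φ' t' ≤ 0 := by
  obtain ⟨ε, hε, H⟩ := exists_box_neg (Φ.continuousOn_twoPointSndSnd μ) (θ := θ) (φ := θ) ht (by
    have hu := Φ.unit (θ, t) (mem_strip.2 ht)
    have := mul_pos (sub_pos.2 hμ) hκ
    simp only [sub_self, mul_zero, sub_zero]
    have e : 2 * Φ.κ (θ, t) * (Φ.n (θ, t) * Φ.n (θ, t) + Φ.m (θ, t) * Φ.m (θ, t))
      = 2 * Φ.κ (θ, t) := by linear_combination 2 * Φ.κ (θ, t) * hu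
    rw [e]; linarith)
  refine ⟨ε, hε, fun θ' φ' t' h1 h2 h3 h4 => ?_⟩
  have ht' : t' ∈ Ico 0 T := ⟨ht.1.trans h4.1, h4.2⟩
  have e := Φ.twoPoint_add_period (μ := μ) ht' θ' (φ' - k * (2 * Real.pi)) 0 k
  rw [sub_add_cancel, Int.cast_zero, zero_mul, add_zero] at e
  rw [e, Φ.twoPoint_eq μ ht']
  refine FramedCurve.twoPoint_nonpos_of_sndSnd_nonpos _ fun ξ hξ => (H θ' ξ t' h1 ?_ h3 ht').le
  have hb1 : θ' ∈ Metric.ball θ ε := by rwa [Metric.mem_ball, Real.dist_eq]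
  have hb2 : φ' - k * (2 * Real.pi) ∈ Metric.ball θ ε := by
    rw [Metric.mem_ball, Real.dist_eq]; convert h2 using 2; ring
  have := (convex_ball θ ε).ordConnected.uIcc_subset hb1 hb2 hξ
  rwa [Metric.mem_ball, Real.dist_eq] at this

theorem twoPoint_box (hp : 1 < p) (hμ : 1 < μ)
    (hpinch : μ ^ p - 1 + (μ - 1) * (p - 2 * (p - 1) / μ - 2 * √p) < 0) {t : ℝ}
    (ht : t ∈ Ico 0 T) (hle : ∀ θ φ, Φ.twoPoint μ θ φ t ≤ 0) (θ φ : ℝ) :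
    ∃ ε > 0, ∀ θ' φ' t', |θ' - θ| < ε → |φ' - φ| < ε → |t' - t| < ε → t' ∈ Ico t T →
      Φ.twoPoint μ θ' φ' t' ≤ 0 := by
  have hκ := Φ.curvature_pos (by linarith) ht hle
  rcases (hle θ φ).lt_or_eq with h | h
  · exact Φ.twoPoint_box_of_neg ht h
  by_cases hD : 0 < (Φ.x (θ, t) - Φ.x (φ, t)) ^ 2 + (Φ.y (θ, t) - Φ.y (φ, t)) ^ 2
  · exact Φ.twoPoint_box_of_dt_neg ht hle (Φ.twoPointDt_neg hp hμ hpinch ht hle h hD)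
  · have h1 : (Φ.x (θ, t) - Φ.x (φ, t)) ^ 2 = 0 := by
      linarith [sq_nonneg (Φ.x (θ, t) - Φ.x (φ, t)), sq_nonneg (Φ.y (θ, t) - Φ.y (φ, t))]
    have h2 : (Φ.y (θ, t) - Φ.y (φ, t)) ^ 2 = 0 := by
      linarith [sq_nonneg (Φ.x (θ, t) - Φ.x (φ, t)), sq_nonneg (Φ.y (θ, t) - Φ.y (φ, t))]
    obtain ⟨k, rfl⟩ := Φ.injective t ht θ φ (sub_eq_zero.1 (pow_eq_zero_iff two_ne_zero |>.1 h1))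
      (sub_eq_zero.1 (pow_eq_zero_iff two_ne_zero |>.1 h2))
    exact Φ.twoPoint_box_diagonal hμ k ht (hκ θ)

/-- The local boxes are uniform over one compact period square, and periodicity covers all other
parameters. -/
theorem eventually_twoPoint_nonpos (hp : 1 < p) (hμ : 1 < μ)
    (hpinch : μ ^ p - 1 + (μ - 1) * (p - 2 * (p - 1) / μ - 2 * √p) < 0) {t : ℝ}
    (ht : t ∈ Ico 0 T) (hle : ∀ θ φ, Φ.twoPoint μ θ φ t ≤ 0) :
    ∀ᶠ s in 𝓝[>] t, ∀ θ φ, Φ.twoPoint μ θ φ s ≤ 0 := by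
  have hK : IsCompact (Icc (0 : ℝ) (2 * Real.pi) ×ˢ Icc (0 : ℝ) (2 * Real.pi)) :=
    isCompact_Icc.prod isCompact_Icc
  have hev := hK.eventually_forall_of_forall_eventually (x₀ := t)
    (P := fun s z => s ∈ Ico t T → Φ.twoPoint μ z.1 z.2 s ≤ 0) (by
      rintro ⟨θ, φ⟩ -
      obtain ⟨ε, hε, H⟩ := Φ.twoPoint_box hp hμ hpinch ht hle θ φ
      filter_upwards [Metric.ball_mem_nhds (t, θ, φ) hε] with ⟨s, θ', φ'⟩ hz hs
      simp only [Metric.mem_ball, Prod.dist_eq, max_lt_iff, Real.dist_eq] at hz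
      exact H θ' φ' s hz.2.1 hz.2.2 hz.1 hs)
  filter_upwards [nhdsWithin_le_nhds hev, Ioo_mem_nhdsGT ht.2] with s hs hst θ φ
  have hs0 : s ∈ Ico 0 T := ⟨ht.1.trans hst.1.le, hst.2⟩
  have hred : ∀ α : ℝ, ∃ (β : ℝ) (k : ℤ), β ∈ Icc 0 (2 * Real.pi) ∧
      β + k * (2 * Real.pi) = α := fun α => by
    refine ⟨_, toIcoDiv Real.two_pi_pos 0 α,
      Ico_subset_Icc_self (toIcoMod_mem_Ico' Real.two_pi_pos α), ?_⟩
    simp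
  obtain ⟨θ', j, hθ', rfl⟩ := hred θ
  obtain ⟨φ', k, hφ', rfl⟩ := hred φ
  rw [Φ.twoPoint_add_period hs0]
  exact hs (θ', φ') ⟨hθ', hφ'⟩ ⟨hst.1.le, hst.2⟩

/-- Continuity method: the good times form a closed set that extends to the right of each of its
points. -/
theorem twoPoint_nonpos_of_one_lt (hp : 1 < p) (hμ : 1 < μ)
    (hpinch : μ ^ p - 1 + (μ - 1) * (p - 2 * (p - 1) / μ - 2 * √p) < 0)
    (h0 : ∀ θ φ, Φ.twoPoint μ θ φ 0 ≤ 0) {t : ℝ} (ht : t ∈ Ico 0 T) (θ φ : ℝ) :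
    Φ.twoPoint μ θ φ t ≤ 0 := by
  have hsub : Icc 0 t ⊆ Ico 0 T := fun s hs => ⟨hs.1, hs.2.trans_lt ht.2⟩
  have hcl : IsClosed ({s | ∀ θ φ, Φ.twoPoint μ θ φ s ≤ 0} ∩ Icc 0 t) := by
    have e : {s | ∀ θ φ, Φ.twoPoint μ θ φ s ≤ 0} ∩ Icc 0 t
        = ⋂ θ, ⋂ φ, Icc 0 t ∩ Φ.twoPoint μ θ φ ⁻¹' Iic 0 := by
      ext s
      simp only [mem_inter_iff, mem_ofPred_eq, mem_iInter, mem_preimage, mem_Iic]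
      exact ⟨fun h θ φ => ⟨h.2, h.1 θ φ⟩, fun h => ⟨fun θ φ => (h θ φ).2, (h 0 0).1⟩⟩
    rw [e]
    refine isClosed_iInter fun θ => isClosed_iInter fun φ =>
      ContinuousOn.preimage_isClosed_of_isClosed (fun s hs => ?_) isClosed_Icc isClosed_Iic
    exact (Φ.hasDerivWithinAt_twoPoint μ (hsub hs) θ φ).continuousWithinAt.mono hsub
  exact hcl.Icc_subset_of_forall_mem_nhdsWithin h0
    (fun s hs => Φ.eventually_twoPoint_nonpos hp hμ hpinch (hsub (Ico_subset_Icc_self hs.2)) hs.1)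
    ⟨ht.1, le_rfl⟩ θ φ

/-- Nonpositivity of the two-point function is preserved by the flow. -/
theorem twoPoint_nonpos {μ₀ : ℝ} (hp : 1 < p) (hμ₀ : 1 < μ₀)
    (hpinch : ∀ μ, 1 < μ → μ ≤ μ₀ → μ ^ p - 1 + (μ - 1) * (p - 2 * (p - 1) / μ - 2 * √p) < 0)
    (hμ : 1 ≤ μ) (hμ' : μ ≤ μ₀) (h0 : ∀ θ φ, Φ.twoPoint μ θ φ 0 ≤ 0) {t : ℝ}
    (ht : t ∈ Ico 0 T) (θ φ : ℝ) : Φ.twoPoint μ θ φ t ≤ 0 := by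
  rcases hμ.lt_or_eq with h1 | rfl
  · exact Φ.twoPoint_nonpos_of_one_lt hp h1 (hpinch μ h1 hμ') h0 ht θ φ
  have hκ := Φ.curvature_pos one_pos ⟨le_rfl, Φ.T_pos⟩ h0
  have hc : Continuous fun μ => Φ.twoPoint μ θ φ t := by unfold twoPoint; fun_prop
  -- For μ = 1 the diagonal and reaction terms are no longer strict. As κ > 0 initially, Z decreases
  -- in μ at time 0, so the result for each μ > 1 close to 1 applies, and μ ↓ 1.
  refine le_of_tendsto (hc.continuousWithinAt (s := Ioi 1) (x := 1)) ?_
  filter_upwards [Ioc_mem_nhdsGT hμ₀] with μ hμ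
  refine Φ.twoPoint_nonpos_of_one_lt hp hμ.1 (hpinch μ hμ.1 hμ.2) (fun θ φ => ?_) ht θ φ
  refine le_trans ?_ (h0 θ φ)
  unfold twoPoint
  have := hμ.1.le
  have := (hκ θ).le
  gcongr

end FramedFlow

/-! ### The enclosed convex region, its support lines and touching discs -/

section region

variable {M : Set Plane}

theorem subset_enclosedRegion {C : Set Plane} (hC : IsPreconnected C) (hCM : C ⊆ Mᶜ) {z : Plane}
    (hzC : z ∈ C) (hz : z ∈ enclosedRegion M) : C ⊆ enclosedRegion M := fun y hy => by
  have hsub := hC.subset_connectedComponentIn hzC hCM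
  refine ⟨hCM hy, ?_⟩
  rw [← connectedComponentIn_eq (hsub hy)]
  exact hz.2

theorem isOpen_enclosedRegion (hM : IsClosed M) : IsOpen (enclosedRegion M) := by
  rw [isOpen_iff_mem_nhds]
  intro z hz
  have ho : IsOpen (connectedComponentIn Mᶜ z) := hM.isOpen_compl.connectedComponentIn
  have hz' : z ∈ connectedComponentIn Mᶜ z := mem_connectedComponentIn hz.1
  exact mem_of_superset (ho.mem_nhds hz') (subset_enclosedRegion isPreconnected_connectedComponentIn
    (connectedComponentIn_subset _ _) hz' hz)

/-- Every ray from a point of the enclosed region meets the curve. -/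
theorem exists_ray_mem {z e : Plane} (hz : z ∈ enclosedRegion M) (he : e ≠ 0) :
    ∃ s : ℝ, 0 ≤ s ∧ z + s • e ∈ M := by
  by_contra! h
  have hsub : (fun s : ℝ => z + s • e) '' Ici 0 ⊆ connectedComponentIn Mᶜ z := by
    refine IsPreconnected.subset_connectedComponentIn
      (isPreconnected_Ici.image _ (by fun_prop)) ⟨0, by simp, by simp⟩ ?_
    rintro _ ⟨s, hs, rfl⟩
    exact h s hs
  obtain ⟨R, hR⟩ := (hz.2.subset hsub).exists_norm_le
  have hR' : ∀ s : ℝ, 0 ≤ s → s * ‖e‖ ≤ R + ‖z‖ := fun s hs => by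
    have h1 := hR _ ⟨s, hs, rfl⟩
    have h2 := norm_sub_le (z + s • e) z
    rw [add_sub_cancel_left, norm_smul, Real.norm_of_nonneg hs] at h2
    linarith
  have he' : 0 < ‖e‖ := norm_pos_iff.2 he
  have h0 : 0 ≤ R + ‖z‖ := by simpa using hR' 0 le_rfl
  have := hR' ((R + ‖z‖ + 1) / ‖e‖) (by positivity)
  rw [div_mul_cancel₀ _ he'.ne'] at this
  linarith

end region

theorem inner_plane (a b : Plane) : inner ℝ a b = a 0 * b 0 + a 1 * b 1 := by
  simp [PiLp.inner_apply, Fin.sum_univ_two, mul_comm]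

theorem norm_sq_plane (a : Plane) : ‖a‖ ^ 2 = a 0 ^ 2 + a 1 ^ 2 := by
  simp [EuclideanSpace.norm_sq_eq, Fin.sum_univ_two]

/-- In the plane, vectors orthogonal to the same nonzero vector are parallel. -/
theorem eq_inner_smul_of_orthogonal {a n N : Plane} (ha : a ≠ 0) (hn : ‖n‖ = 1)
    (hna : inner ℝ n a = 0) (hNa : inner ℝ N a = 0) : N = (inner ℝ N n : ℝ) • n := by
  have h1 : n 0 ^ 2 + n 1 ^ 2 = 1 := by rw [← norm_sq_plane, hn]; norm_num
  rw [inner_plane] at hna hNa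
  have ha' : a 0 ^ 2 + a 1 ^ 2 ≠ 0 := by
    rw [← norm_sq_plane]; exact pow_ne_zero 2 (norm_ne_zero_iff.2 ha)
  have hc : n 0 * N 1 - n 1 * N 0 = 0 := by
    refine mul_left_cancel₀ ha' ?_
    linear_combination (a 0 * N 1 - a 1 * N 0) * hna - (a 0 * n 1 - a 1 * n 0) * hNa
  rw [inner_plane]
  ext i
  fin_cases i
  · simp
    linear_combination (-N 0) * h1 - n 1 * hc
  · simp
    linear_combination (-N 1) * h1 + n 0 * hc

section convexCurve

variable {γ ν : Circle → Plane}

theorem isClosed_range_curve (hγ : IsConvexEmbedding γ) : IsClosed (range γ) :=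
  (isCompact_range hγ.smooth.continuous).isClosed

theorem lift_mem_range (γ : Circle → Plane) (θ : ℝ) : lift γ θ ∈ range γ := ⟨_, rfl⟩

theorem lift_mem_closure (hν : ∀ θ, IsOutwardUnitNormal γ θ (lift ν θ)) (θ : ℝ) :
    lift γ θ ∈ closure (enclosedRegion (range γ)) := by
  have h1 : Tendsto (fun s : ℝ => lift γ θ - s • lift ν θ) (𝓝[>] 0) (𝓝 (lift γ θ)) := by
    have : Continuous fun s : ℝ => lift γ θ - s • lift ν θ := by fun_prop
    simpa using (this.tendsto 0).mono_left nhdsWithin_le_nhds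
  exact mem_closure_of_tendsto h1 (hν θ).outward

/-- A convex region lies strictly on the inner side of its tangent lines. -/
theorem inner_sub_lt_zero (hγ : IsConvexEmbedding γ)
    (hν : ∀ θ, IsOutwardUnitNormal γ θ (lift ν θ)) (θ : ℝ) {z : Plane}
    (hz : z ∈ enclosedRegion (range γ)) : inner ℝ (z - lift γ θ) (lift ν θ) < 0 := by
  obtain ⟨f, hf⟩ := geometric_hahn_banach_open_point hγ.convex
    (isOpen_enclosedRegion (isClosed_range_curve hγ)) (x := lift γ θ)
    (fun h => h.1 (lift_mem_range γ θ))
  set N : Plane := (InnerProductSpace.toDual ℝ Plane).symm f with hN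
  have hNf : ∀ y, inner ℝ N y = f y := fun y => by simp [hN]
  have hle : ∀ φ, f (lift γ φ) ≤ f (lift γ θ) := fun φ =>
    closure_minimal (fun y hy => (hf y hy).le) (isClosed_le f.continuous continuous_const)
      (lift_mem_closure hν φ)
  -- `deriv` defaults to zero where the derivative does not exist, so the immersion condition forces
  -- differentiability.
  have hd : DifferentiableAt ℝ (lift γ) θ := by
    by_contra h
    exact hγ.immersion θ (deriv_zero_of_not_differentiableAt h)
  have hmax : IsLocalMax (fun φ => f (lift γ φ)) θ := Eventually.of_forall hle
  have horth : inner ℝ N (deriv (lift γ) θ) = 0 := by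
    rw [hNf]
    exact hmax.hasDerivAt_eq_zero (f.hasFDerivAt.comp_hasDerivAt θ hd.hasDerivAt)
  have hpar := eq_inner_smul_of_orthogonal (hγ.immersion θ) (hν θ).norm_eq_one
    (hν θ).orthogonal horth
  -- The separating vector is a multiple of ν; an inner point X - sν shows that the multiple is
  -- positive.
  obtain ⟨s, hs, hs0⟩ := ((hν θ).outward.and self_mem_nhdsWithin).exists
  have hc : 0 < (inner ℝ N (lift ν θ) : ℝ) := by
    have := hf _ hs
    rw [map_sub, map_smul, ← hNf (lift ν θ), smul_eq_mul] at this
    exact (mul_pos_iff_of_pos_left (mem_Ioi.1 hs0)).1 (by linarith)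
  have h1 : inner ℝ N (z - lift γ θ) < 0 := by
    rw [hNf, map_sub]; linarith [hf z hz]
  rw [hpar, real_inner_smul_left] at h1
  rw [real_inner_comm]
  exact neg_of_mul_neg_right h1 hc.le

theorem inner_lift_sub_nonpos (hγ : IsConvexEmbedding γ)
    (hν : ∀ θ, IsOutwardUnitNormal γ θ (lift ν θ)) (θ φ : ℝ) :
    inner ℝ (lift γ φ - lift γ θ) (lift ν θ) ≤ 0 :=
  closure_minimal (t := {z | inner ℝ (z - lift γ θ) (lift ν θ) ≤ (0 : ℝ)})
    (fun _ hz => (inner_sub_lt_zero hγ hν θ hz).le)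
    (isClosed_le (by fun_prop) continuous_const) (lift_mem_closure hν φ)

/-- Start at an enclosed point, which is strictly inside the tangent line, and follow the ray in
direction -ν until it meets the curve. -/
theorem exists_inner_lift_sub_neg (hγ : IsConvexEmbedding γ)
    (hν : ∀ θ, IsOutwardUnitNormal γ θ (lift ν θ)) (θ : ℝ) :
    ∃ φ, inner ℝ (lift γ φ - lift γ θ) (lift ν θ) < 0 := by
  obtain ⟨s, hs⟩ := (hν θ).outward.exists
  have hn := (hν θ).norm_eq_one
  obtain ⟨r, hr, z, hz⟩ := exists_ray_mem hs (e := -lift ν θ) (by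
    rw [neg_ne_zero, ← norm_ne_zero_iff, hn]; exact one_ne_zero)
  obtain ⟨φ, rfl⟩ := Circle.exp_surjective z
  refine ⟨φ, ?_⟩
  have h1 := inner_sub_lt_zero hγ hν θ hs
  rw [lift, hz, add_sub_right_comm, inner_add_left, smul_neg, inner_neg_left, real_inner_smul_left,
    real_inner_self_eq_norm_sq, hn]
  linarith

/-- Non-collapsing in terms of the two-point function. -/
theorem isNonCollapsed_iff (hγ : IsConvexEmbedding γ)
    (hν : ∀ θ, IsOutwardUnitNormal γ θ (lift ν θ)) {μ : ℝ} (hμ : 0 < μ) :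
    IsNonCollapsed μ γ ν ↔ ∀ θ, 0 < curvature γ ν θ ∧ ∀ φ,
      2 * inner ℝ (lift γ θ - lift γ φ) (lift ν θ)
        - μ * curvature γ ν θ * ‖lift γ θ - lift γ φ‖ ^ 2 ≤ 0 := by
  refine forall_congr' fun θ => and_congr_right fun hκ => ?_
  set r := 1 / (μ * curvature γ ν θ) with hr
  have hk : 0 < μ * curvature γ ν θ := mul_pos hμ hκ
  have hr0 : 0 < r := by positivity
  have hkr : μ * curvature γ ν θ * r = 1 := by rw [hr]; field_simp
  have hn := (hν θ).norm_eq_one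
  have hdist : ∀ φ, ‖lift γ φ - (lift γ θ - r • lift ν θ)‖ ^ 2 = r ^ 2 +
      (‖lift γ θ - lift γ φ‖ ^ 2 - 2 * r * inner ℝ (lift γ θ - lift γ φ) (lift ν θ)) := fun φ => by
    have : lift γ φ - (lift γ θ - r • lift ν θ) = r • lift ν θ - (lift γ θ - lift γ φ) := by abel
    rw [this, norm_sub_sq_real, norm_smul, hn, real_inner_smul_left, real_inner_comm,
      Real.norm_of_nonneg hr0.le]
    ring
  have hiff : ∀ φ, 2 * inner ℝ (lift γ θ - lift γ φ) (lift ν θ)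
      - μ * curvature γ ν θ * ‖lift γ θ - lift γ φ‖ ^ 2 ≤ 0 ↔
      r ^ 2 ≤ ‖lift γ φ - (lift γ θ - r • lift ν θ)‖ ^ 2 := fun φ => by
    rw [hdist, le_add_iff_nonneg_right]
    have : ‖lift γ θ - lift γ φ‖ ^ 2 - 2 * r * inner ℝ (lift γ θ - lift γ φ) (lift ν θ)
      = r * -(2 * inner ℝ (lift γ θ - lift γ φ) (lift ν θ)
        - μ * curvature γ ν θ * ‖lift γ θ - lift γ φ‖ ^ 2) := by
      linear_combination (-‖lift γ θ - lift γ φ‖ ^ 2) * hkr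
    rw [this, mul_nonneg_iff_of_pos_left hr0, neg_nonneg]
  simp only [hiff]
  constructor
  · rintro ⟨c, hball, hc⟩ φ
    -- The center is forced: the disc lies in the half-plane of the tangent line, so r ≤ ⟨X - c, ν⟩,
    -- and |X - c| = r makes this the equality case of Cauchy–Schwarz.
    have hcν : lift γ θ - c = r • lift ν θ := by
      have h1 : inner ℝ (c + r • lift ν θ - lift γ θ) (lift ν θ) ≤ (0 : ℝ) := by
        refine closure_minimal (t := {z | inner ℝ (z - lift γ θ) (lift ν θ) ≤ (0 : ℝ)})
          (fun z hz => (inner_sub_lt_zero hγ hν θ (hball hz)).le)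
          (isClosed_le (by fun_prop) continuous_const) ?_
        rw [closure_ball _ hr0.ne', Metric.mem_closedBall, dist_eq_norm, add_sub_cancel_left,
          norm_smul, hn, Real.norm_of_nonneg hr0.le, mul_one]
      have h2 : ‖lift γ θ - c‖ = r := by rwa [mem_sphere_iff_norm] at hc
      have h3 : ‖lift γ θ - c - r • lift ν θ‖ ^ 2 ≤ 0 := by
        rw [norm_sub_sq_real, h2, norm_smul, hn, real_inner_smul_right, Real.norm_of_nonneg hr0.le]
        have h4 : c + r • lift ν θ - lift γ θ = r • lift ν θ - (lift γ θ - c) := by abel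
        rw [h4, inner_sub_left, real_inner_smul_left, real_inner_self_eq_norm_sq, hn] at h1
        nlinarith
      have h5 : ‖lift γ θ - c - r • lift ν θ‖ = 0 :=
        pow_eq_zero_iff two_ne_zero |>.1 (le_antisymm h3 (by positivity))
      exact sub_eq_zero.1 (norm_eq_zero.1 h5)
    rw [← hcν, sub_sub_cancel]
    have hnot : lift γ φ ∉ Metric.ball c r := fun h => (hball h).1 (lift_mem_range γ φ)
    rw [Metric.mem_ball, dist_eq_norm, not_lt] at hnot
    gcongr
  · intro h
    refine ⟨lift γ θ - r • lift ν θ, ?_, ?_⟩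
    -- The disc avoids the curve and is connected, so one enclosed point X - sν with 0 < s < r puts
    -- all of it in the region.
    · obtain ⟨s, hs, hs0, hs1⟩ := ((hν θ).outward.and (Ioo_mem_nhdsGT hr0)).exists
      refine subset_enclosedRegion (Metric.isPreconnected_ball) ?_ (z := lift γ θ - s • lift ν θ)
        ?_ hs
      · rintro _ hz ⟨z, rfl⟩
        obtain ⟨φ, rfl⟩ := Circle.exp_surjective z
        rw [Metric.mem_ball, dist_eq_norm] at hz
        have := h φ
        rw [pow_le_pow_iff_left₀ hr0.le (norm_nonneg _) two_ne_zero] at this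
        exact absurd hz (not_lt.2 this)
      · rw [Metric.mem_ball, dist_eq_norm, sub_sub_sub_cancel_left, ← sub_smul, norm_smul, hn,
          mul_one, Real.norm_of_nonneg (by linarith)]
        linarith
    · rw [mem_sphere_iff_norm, sub_sub_cancel, norm_smul, hn, Real.norm_of_nonneg hr0.le, mul_one]

end convexCurve

/-! ### From the geometric flow to coordinates -/

theorem hasDerivAt_coord {h : ℝ → Plane} {h' : Plane} {θ : ℝ} (hh : HasDerivAt h h' θ)
    (i : Fin 2) : HasDerivAt (fun s => h s i) (h' i) θ :=
  (EuclideanSpace.proj (𝕜 := ℝ) i).hasFDerivAt.comp_hasDerivAt θ hh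

theorem hasDerivWithinAt_coord {h : ℝ → Plane} {h' : Plane} {s : Set ℝ} {t : ℝ}
    (hh : HasDerivWithinAt h h' s t) (i : Fin 2) : HasDerivWithinAt (fun s => h s i) (h' i) s t :=
  (EuclideanSpace.proj (𝕜 := ℝ) i).hasFDerivAt.comp_hasDerivWithinAt t hh

theorem contDiff_lift {γ : Circle → Plane} (hγ : IsConvexEmbedding γ) : ContDiff ℝ ∞ (lift γ) :=
  (hγ.smooth.comp contMDiff_circleExp).contDiff

theorem lift_add_period (γ : Circle → Plane) (θ : ℝ) (k : ℤ) :
    lift γ (θ + k * (2 * Real.pi)) = lift γ θ := by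
  unfold lift
  rw [Circle.exp_eq_exp.2 ⟨k, rfl⟩]

theorem curvature_add_period (γ ν : Circle → Plane) (θ : ℝ) (k : ℤ) :
    curvature γ ν (θ + k * (2 * Real.pi)) = curvature γ ν θ := by
  have h1 : ∀ s, deriv (lift γ) (s + k * (2 * Real.pi)) = deriv (lift γ) s := fun s => by
    rw [← deriv_comp_add_const, funext fun r => lift_add_period γ r k]
  have h2 : deriv (deriv (lift γ)) (θ + k * (2 * Real.pi)) = deriv (deriv (lift γ)) θ := by
    rw [← deriv_comp_add_const, funext h1]
  unfold curvature
  rw [h1, h2, lift_add_period]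

namespace IsConvexPowerCurvatureFlow

variable {p T : ℝ} {X ν : Circle → ℝ → Plane}

/-- The coordinates of a lifted family of curves. -/
def coord (X : Circle → ℝ → Plane) (i : Fin 2) (q : ℝ × ℝ) : ℝ := X (Circle.exp q.1) q.2 i

theorem contDiffOn_coord (h : IsConvexPowerCurvatureFlow p T X ν) (i : Fin 2) :
    ContDiffOn ℝ ∞ (coord X i) (strip T) := by
  have h1 : ContMDiff 𝓘(ℝ, ℝ × ℝ) ((𝓡 1).prod 𝓘(ℝ, ℝ)) ∞
      (fun q : ℝ × ℝ => (Circle.exp q.1, q.2)) :=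
    (contMDiff_circleExp.comp contDiff_fst.contMDiff).prodMk contDiff_snd.contMDiff
  have h2 : ContDiffOn ℝ ∞ (fun q : ℝ × ℝ => X (Circle.exp q.1) q.2) (strip T) :=
    (h.smooth.comp (h1.contMDiffOn (s := strip T)) fun q hq => ⟨mem_univ _, hq.2⟩).contDiffOn
  exact contDiffOn_euclidean.1 h2 i

theorem normal_lift (h : IsConvexPowerCurvatureFlow p T X ν) {t : ℝ} (ht : t ∈ Ico 0 T) (θ : ℝ) :
    IsOutwardUnitNormal (fun z => X z t) θ (lift (fun z => ν z t) θ) := h.normal t ht θ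

theorem deriv_lift_apply (h : IsConvexPowerCurvatureFlow p T X ν) {t : ℝ} (ht : t ∈ Ico 0 T)
    (θ : ℝ) (i : Fin 2) : deriv (lift fun z => X z t) θ i = dθ T (coord X i) (θ, t) := by
  have hd := (contDiff_lift (h.convexEmbedding t ht)).differentiable (by simp) θ
  exact (hasDerivAt_coord hd.hasDerivAt i).unique (hasDerivAt_dθ (h.contDiffOn_coord i) ht θ)

theorem deriv_deriv_lift_apply (h : IsConvexPowerCurvatureFlow p T X ν) {t : ℝ} (ht : t ∈ Ico 0 T)
    (θ : ℝ) (i : Fin 2) :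
    deriv (deriv (lift fun z => X z t)) θ i = dθ T (dθ T (coord X i)) (θ, t) := by
  have hc : ContDiff ℝ ∞ (deriv (lift fun z => X z t)) :=
    (contDiff_infty_iff_deriv.1 (contDiff_lift (h.convexEmbedding t ht))).2
  have hd := hasDerivAt_coord (hc.differentiable (by simp) θ).hasDerivAt i
  rw [funext fun s => h.deriv_lift_apply ht s i] at hd
  exact hd.unique (hasDerivAt_dθ (contDiffOn_dθ (h.contDiffOn_coord i)) ht θ)

theorem unit (h : IsConvexPowerCurvatureFlow p T X ν) {q : ℝ × ℝ} (hq : q ∈ strip T) :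
    coord ν 0 q ^ 2 + coord ν 1 q ^ 2 = 1 := by
  have := (h.normal q.2 hq.2 q.1).norm_eq_one
  rw [coord, coord, ← norm_sq_plane, this, one_pow]

theorem orthogonal (h : IsConvexPowerCurvatureFlow p T X ν) {q : ℝ × ℝ} (hq : q ∈ strip T) :
    coord ν 0 q * dθ T (coord X 0) q + coord ν 1 q * dθ T (coord X 1) q = 0 := by
  have := (h.normal q.2 hq.2 q.1).orthogonal
  rwa [inner_plane, h.deriv_lift_apply hq.2, h.deriv_lift_apply hq.2] at this

theorem speedSq_pos (h : IsConvexPowerCurvatureFlow p T X ν) {q : ℝ × ℝ} (hq : q ∈ strip T) :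
    0 < dθ T (coord X 0) q ^ 2 + dθ T (coord X 1) q ^ 2 := by
  have := (h.convexEmbedding q.2 hq.2).immersion q.1
  have h2 : 0 < ‖deriv (lift fun z => X z q.2) q.1‖ ^ 2 := by positivity
  rwa [norm_sq_plane, h.deriv_lift_apply hq.2, h.deriv_lift_apply hq.2] at h2

theorem convex_coord (h : IsConvexPowerCurvatureFlow p T X ν) {t : ℝ} (ht : t ∈ Ico 0 T)
    (θ φ : ℝ) :
    (coord X 0 (φ, t) - coord X 0 (θ, t)) * coord ν 0 (θ, t)
      + (coord X 1 (φ, t) - coord X 1 (θ, t)) * coord ν 1 (θ, t) ≤ 0 := by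
  have := inner_lift_sub_nonpos (h.convexEmbedding t ht) (h.normal_lift ht) θ φ
  rwa [inner_plane] at this

theorem exists_strict_coord (h : IsConvexPowerCurvatureFlow p T X ν) {t : ℝ} (ht : t ∈ Ico 0 T)
    (θ : ℝ) : ∃ φ,
    (coord X 0 (φ, t) - coord X 0 (θ, t)) * coord ν 0 (θ, t)
      + (coord X 1 (φ, t) - coord X 1 (θ, t)) * coord ν 1 (θ, t) < 0 := by
  obtain ⟨φ, hφ⟩ := exists_inner_lift_sub_neg (h.convexEmbedding t ht) (h.normal_lift ht) θ
  rw [inner_plane] at hφ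
  exact ⟨φ, hφ⟩

/-- The signed speed of the parametrization along the rotated outward normal. -/
def signedSpeed (T : ℝ) (X ν : Circle → ℝ → Plane) (q : ℝ × ℝ) : ℝ :=
  coord ν 0 q * dθ T (coord X 1) q - coord ν 1 q * dθ T (coord X 0) q

theorem signedSpeed_sq (h : IsConvexPowerCurvatureFlow p T X ν) {q : ℝ × ℝ} (hq : q ∈ strip T) :
    signedSpeed T X ν q ^ 2 = dθ T (coord X 0) q ^ 2 + dθ T (coord X 1) q ^ 2 := by
  have h1 := h.unit hq
  have h2 := h.orthogonal hq
  unfold signedSpeed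
  linear_combination (dθ T (coord X 0) q ^ 2 + dθ T (coord X 1) q ^ 2) * h1
    - (coord ν 0 q * dθ T (coord X 0) q + coord ν 1 q * dθ T (coord X 1) q) * h2

theorem signedSpeed_ne (h : IsConvexPowerCurvatureFlow p T X ν) {q : ℝ × ℝ} (hq : q ∈ strip T) :
    signedSpeed T X ν q ≠ 0 := by
  have h1 := h.speedSq_pos hq
  rw [← h.signedSpeed_sq hq] at h1
  exact pow_ne_zero_iff two_ne_zero |>.1 h1.ne'

theorem dθ_coord (h : IsConvexPowerCurvatureFlow p T X ν) {q : ℝ × ℝ} (hq : q ∈ strip T) :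
    dθ T (coord X 0) q = -1 * (signedSpeed T X ν q * coord ν 1 q) ∧
      dθ T (coord X 1) q = 1 * (signedSpeed T X ν q * coord ν 0 q) := by
  have h1 := h.unit hq
  have h2 := h.orthogonal hq
  unfold signedSpeed
  constructor
  · linear_combination (-dθ T (coord X 0) q) * h1 + coord ν 0 q * h2
  · linear_combination (-dθ T (coord X 1) q) * h1 + coord ν 1 q * h2

/-- The orientation of the parametrization. -/
def orientation (T : ℝ) (X ν : Circle → ℝ → Plane) (q : ℝ × ℝ) : ℝ :=
  SignType.sign (signedSpeed T X ν q)

/-- Continuity of ν is not available. The cross product `G` of a chord to a fixed parameter φ with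
the tangent involves only X, hence is continuous; it equals the signed speed times a nonpositive
height, so where it is nonzero it determines the sign of the signed speed. -/
theorem eventually_orientation_eq (h : IsConvexPowerCurvatureFlow p T X ν) {q : ℝ × ℝ}
    (hq : q ∈ strip T) :
    ∀ᶠ q' in 𝓝[strip T] q, orientation T X ν q = orientation T X ν q' := by
  obtain ⟨θ, t⟩ := q
  obtain ⟨φ, hφ⟩ := h.exists_strict_coord hq.2 θ
  set G : ℝ × ℝ → ℝ := fun z =>
    (coord X 0 (φ, z.2) - coord X 0 z) * dθ T (coord X 1) z
      - (coord X 1 (φ, z.2) - coord X 1 z) * dθ T (coord X 0) z with hGdef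
  have hG : ContinuousOn G (strip T) := by
    have c : ∀ i, ContinuousOn (fun z : ℝ × ℝ => coord X i (φ, z.2)) (strip T) := fun i =>
      (h.contDiffOn_coord i).continuousOn.comp (by fun_prop) fun z hz => mem_strip.2 hz.2
    exact (((c 0).sub (h.contDiffOn_coord 0).continuousOn).mul
      (contDiffOn_dθ (h.contDiffOn_coord 1)).continuousOn).sub
      (((c 1).sub (h.contDiffOn_coord 1).continuousOn).mul
      (contDiffOn_dθ (h.contDiffOn_coord 0)).continuousOn)
  -- `G` is the signed speed times the height of the point `φ` over the tangent line
  have hGeq : ∀ z ∈ strip T, G z = signedSpeed T X ν z *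
      ((coord X 0 (φ, z.2) - coord X 0 z) * coord ν 0 z
        + (coord X 1 (φ, z.2) - coord X 1 z) * coord ν 1 z) := fun z hz => by
    simp only [hGdef]
    rw [(h.dθ_coord hz).1, (h.dθ_coord hz).2]
    ring
  have hle : ∀ z ∈ strip T, (coord X 0 (φ, z.2) - coord X 0 z) * coord ν 0 z
        + (coord X 1 (φ, z.2) - coord X 1 z) * coord ν 1 z ≤ 0 := fun z hz =>
    h.convex_coord hz.2 z.1 φ
  rcases lt_or_gt_of_ne (h.signedSpeed_ne hq) with hv | hv
  · have h0 : 0 < G (θ, t) := by rw [hGeq _ hq]; exact mul_pos_of_neg_of_neg hv hφ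
    filter_upwards [(hG _ hq).eventually_const_lt h0, self_mem_nhdsWithin] with z hz hzs
    rw [hGeq z hzs] at hz
    have hvz : signedSpeed T X ν z < 0 := by
      by_contra! hc
      linarith [mul_nonpos_of_nonneg_of_nonpos hc (hle z hzs)]
    simp [orientation, sign_neg hv, sign_neg hvz]
  · have h0 : G (θ, t) < 0 := by rw [hGeq _ hq]; exact mul_neg_of_pos_of_neg hv hφ
    filter_upwards [(hG _ hq).eventually_lt_const h0, self_mem_nhdsWithin] with z hz hzs
    rw [hGeq z hzs] at hz
    have hvz : 0 < signedSpeed T X ν z := by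
      by_contra! hc
      linarith [mul_nonneg_of_nonpos_of_nonpos hc (hle z hzs)]
    simp [orientation, sign_pos hv, sign_pos hvz]

theorem orientation_const (h : IsConvexPowerCurvatureFlow p T X ν) {q q' : ℝ × ℝ}
    (hq : q ∈ strip T) (hq' : q' ∈ strip T) : orientation T X ν q = orientation T X ν q' :=
  (convex_univ.prod (convex_Ico 0 T)).isPreconnected.induction₂
    (fun z z' => orientation T X ν z = orientation T X ν z')
    (fun _ hz => h.eventually_orientation_eq hz) (fun _ _ _ _ _ _ => Eq.trans)
    (fun _ _ _ _ => Eq.symm) hq hq'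

theorem signedSpeed_eq (h : IsConvexPowerCurvatureFlow p T X ν) {q : ℝ × ℝ} (hq : q ∈ strip T) :
    signedSpeed T X ν q = orientation T X ν q *
      √(dθ T (coord X 0) q ^ 2 + dθ T (coord X 1) q ^ 2) := by
  rw [← h.signedSpeed_sq hq, Real.sqrt_sq_eq_abs, orientation, sign_mul_abs]

theorem contDiffOn_signedSpeed (hT : 0 < T) (h : IsConvexPowerCurvatureFlow p T X ν) :
    ContDiffOn ℝ ∞ (signedSpeed T X ν) (strip T) := by
  have h0 : ((0 : ℝ), (0 : ℝ)) ∈ strip T := mem_strip.2 ⟨le_rfl, hT⟩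
  -- With constant orientation the signed speed is a fixed sign times |∂θX|, which is smooth because
  -- it never vanishes.
  refine ContDiffOn.congr (f := fun q => orientation T X ν (0, 0) *
    √(dθ T (coord X 0) q ^ 2 + dθ T (coord X 1) q ^ 2)) ?_
    fun q hq => by rw [h.signedSpeed_eq hq, h.orientation_const hq h0]
  exact contDiffOn_const.mul ((((contDiffOn_dθ (h.contDiffOn_coord 0)).pow 2).add
    ((contDiffOn_dθ (h.contDiffOn_coord 1)).pow 2)).sqrt fun q hq => (h.speedSq_pos hq).ne')

theorem contDiffOn_normal_fst (hT : 0 < T) (h : IsConvexPowerCurvatureFlow p T X ν) :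
    ContDiffOn ℝ ∞ (coord ν 0) (strip T) := by
  refine ((contDiffOn_dθ (h.contDiffOn_coord 1)).div (h.contDiffOn_signedSpeed hT)
    fun q hq => h.signedSpeed_ne hq).congr fun q hq => ?_
  rw [Pi.div_apply, eq_div_iff (h.signedSpeed_ne hq), (h.dθ_coord hq).2]
  ring

theorem contDiffOn_normal_snd (hT : 0 < T) (h : IsConvexPowerCurvatureFlow p T X ν) :
    ContDiffOn ℝ ∞ (coord ν 1) (strip T) := by
  refine ((contDiffOn_dθ (h.contDiffOn_coord 0)).neg.div (h.contDiffOn_signedSpeed hT)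
    fun q hq => h.signedSpeed_ne hq).congr fun q hq => ?_
  rw [Pi.div_apply, eq_div_iff (h.signedSpeed_ne hq), (h.dθ_coord hq).1]
  ring

/-- The curvature as a function on space-time. -/
def curv (X ν : Circle → ℝ → Plane) (q : ℝ × ℝ) : ℝ :=
  curvature (fun z => X z q.2) (fun z => ν z q.2) q.1

theorem curv_eq (h : IsConvexPowerCurvatureFlow p T X ν) {q : ℝ × ℝ} (hq : q ∈ strip T) :
    curv X ν q = -(dθ T (dθ T (coord X 0)) q * coord ν 0 q
      + dθ T (dθ T (coord X 1)) q * coord ν 1 q) / signedSpeed T X ν q ^ 2 := by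
  rw [curv, curvature, inner_plane, norm_sq_plane, h.deriv_lift_apply hq.2,
    h.deriv_lift_apply hq.2, h.deriv_deriv_lift_apply hq.2, h.deriv_deriv_lift_apply hq.2,
    h.signedSpeed_sq hq]
  rfl

theorem contDiffOn_curv (hT : 0 < T) (h : IsConvexPowerCurvatureFlow p T X ν) :
    ContDiffOn ℝ ∞ (curv X ν) (strip T) := by
  refine ContDiffOn.congr ?_ fun q hq => h.curv_eq hq
  refine ContDiffOn.div ?_ ((h.contDiffOn_signedSpeed hT).pow 2)
    fun q hq => pow_ne_zero 2 (h.signedSpeed_ne hq)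
  exact (((contDiffOn_dθ (contDiffOn_dθ (h.contDiffOn_coord 0))).mul
    (h.contDiffOn_normal_fst hT)).add ((contDiffOn_dθ (contDiffOn_dθ (h.contDiffOn_coord 1))).mul
    (h.contDiffOn_normal_snd hT))).neg

/-- The Frenet equation for ν: differentiating |ν|² = 1 makes ∂θν tangential, and differentiating
⟨ν, ∂θX⟩ = 0 identifies its size. -/
theorem dθ_normal (hT : 0 < T) (h : IsConvexPowerCurvatureFlow p T X ν) {q : ℝ × ℝ}
    (hq : q ∈ strip T) :
    dθ T (coord ν 0) q = -1 * ((curv X ν q * signedSpeed T X ν q) * coord ν 1 q) ∧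
      dθ T (coord ν 1) q = 1 * ((curv X ν q * signedSpeed T X ν q) * coord ν 0 q) := by
  obtain ⟨θ, t⟩ := q
  have ht : t ∈ Ico 0 T := hq.2
  have hn := hasDerivAt_dθ (h.contDiffOn_normal_fst hT) ht θ
  have hm := hasDerivAt_dθ (h.contDiffOn_normal_snd hT) ht θ
  have hx := hasDerivAt_dθ (contDiffOn_dθ (h.contDiffOn_coord 0)) ht θ
  have hy := hasDerivAt_dθ (contDiffOn_dθ (h.contDiffOn_coord 1)) ht θ
  have e1 : (fun s => coord ν 0 (s, t) ^ 2 + coord ν 1 (s, t) ^ 2) = fun _ => 1 :=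
    funext fun s => h.unit (mem_strip.2 ht)
  have e2 : (fun s => coord ν 0 (s, t) * dθ T (coord X 0) (s, t)
      + coord ν 1 (s, t) * dθ T (coord X 1) (s, t)) = fun _ => 0 :=
    funext fun s => h.orthogonal (mem_strip.2 ht)
  have d1 : HasDerivAt (fun s => coord ν 0 (s, t) ^ 2 + coord ν 1 (s, t) ^ 2) _ θ :=
    (hn.pow 2).add (hm.pow 2)
  have d2 : HasDerivAt (fun s => coord ν 0 (s, t) * dθ T (coord X 0) (s, t)
      + coord ν 1 (s, t) * dθ T (coord X 1) (s, t)) _ θ := (hn.mul hx).add (hm.mul hy)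
  rw [e1] at d1
  rw [e2] at d2
  have r1 := d1.unique (hasDerivAt_const θ _)
  have r2 := d2.unique (hasDerivAt_const θ _)
  simp only [Nat.cast_ofNat, Nat.add_one_sub_one, pow_one] at r1
  have hu := h.unit hq
  have hv := h.signedSpeed_ne hq
  have hκ : curv X ν (θ, t) * signedSpeed T X ν (θ, t) =
      coord ν 0 (θ, t) * dθ T (coord ν 1) (θ, t) - coord ν 1 (θ, t) * dθ T (coord ν 0) (θ, t) := by
    have h3 := h.curv_eq hq
    rw [eq_div_iff (pow_ne_zero 2 hv)] at h3
    refine mul_right_cancel₀ hv ?_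
    rw [(h.dθ_coord hq).1, (h.dθ_coord hq).2] at r2
    linear_combination h3 - r2
  rw [hκ]
  constructor
  · linear_combination (-dθ T (coord ν 0) (θ, t)) * hu + coord ν 0 (θ, t) / 2 * r1
  · linear_combination (-dθ T (coord ν 1) (θ, t)) * hu + coord ν 1 (θ, t) / 2 * r1

theorem dt_coord (h : IsConvexPowerCurvatureFlow p T X ν) {q : ℝ × ℝ} (hq : q ∈ strip T)
    (i : Fin 2) : dt T (coord X i) q = -1 * (curv X ν q ^ p * coord ν i q) := by
  obtain ⟨θ, t⟩ := q
  refine dt_eq_of_hasDerivWithinAt (h.contDiffOn_coord i) hq.2 ?_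
  refine (hasDerivWithinAt_coord (h.flow t hq.2 θ) i).congr_deriv ?_
  simp [curv, coord]

/-- The normal speed of the flow. -/
def speed (T : ℝ) (X ν : Circle → ℝ → Plane) (q : ℝ × ℝ) : ℝ :=
  -(dt T (coord X 0) q * coord ν 0 q + dt T (coord X 1) q * coord ν 1 q)

theorem speed_eq (h : IsConvexPowerCurvatureFlow p T X ν) {q : ℝ × ℝ} (hq : q ∈ strip T) :
    speed T X ν q = curv X ν q ^ p := by
  rw [speed, h.dt_coord hq, h.dt_coord hq]
  linear_combination (curv X ν q ^ p) * h.unit hq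

/-- The coordinate description of a convex power curvature flow. -/
def toFramedFlow (hT : 0 < T) (h : IsConvexPowerCurvatureFlow p T X ν) : FramedFlow p T where
  x := coord X 0
  y := coord X 1
  n := coord ν 0
  m := coord ν 1
  v := signedSpeed T X ν
  κ := curv X ν
  f := speed T X ν
  T_pos := hT
  smooth_x := h.contDiffOn_coord 0
  smooth_y := h.contDiffOn_coord 1
  smooth_n := h.contDiffOn_normal_fst hT
  smooth_m := h.contDiffOn_normal_snd hT
  smooth_v := h.contDiffOn_signedSpeed hT
  smooth_κ := h.contDiffOn_curv hT
  -- The speed is taken as -⟨∂ₜX, ν⟩, since smoothness of κ ^ p does not follow from that of κ where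
  -- κ may vanish.
  smooth_f := (((contDiffOn_dt (h.contDiffOn_coord 0)).mul (h.contDiffOn_normal_fst hT)).add
    ((contDiffOn_dt (h.contDiffOn_coord 1)).mul (h.contDiffOn_normal_snd hT))).neg
  unit _ hq := h.unit hq
  v_ne _ hq := h.signedSpeed_ne hq
  f_eq _ hq := h.speed_eq hq
  dθ_x _ hq := (h.dθ_coord hq).1
  dθ_y _ hq := (h.dθ_coord hq).2
  dθ_n _ hq := (h.dθ_normal hT hq).1
  dθ_m _ hq := (h.dθ_normal hT hq).2
  dt_x q hq := by rw [h.speed_eq hq, h.dt_coord hq]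
  dt_y q hq := by rw [h.speed_eq hq, h.dt_coord hq]
  convex _ ht := h.convex_coord ht
  exists_strict _ ht := h.exists_strict_coord ht
  periodic t _ θ k := by
    have hX := lift_add_period (fun z => X z t) θ k
    have hN := lift_add_period (fun z => ν z t) θ k
    exact ⟨congrArg (fun z : Plane => z 0) hX, congrArg (fun z : Plane => z 1) hX,
      congrArg (fun z : Plane => z 0) hN, congrArg (fun z : Plane => z 1) hN,
      curvature_add_period _ _ θ k⟩
  injective t ht θ φ h0 h1 := by
    have : X (Circle.exp φ) t = X (Circle.exp θ) t := by
      ext i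
      fin_cases i
      · exact h0.symm
      · exact h1.symm
    exact Circle.exp_eq_exp.1 ((h.convexEmbedding t ht).injective this)

theorem twoPoint_toFramedFlow (hT : 0 < T) (h : IsConvexPowerCurvatureFlow p T X ν)
    (μ θ φ t : ℝ) : (h.toFramedFlow hT).twoPoint μ θ φ t =
      2 * inner ℝ (lift (fun z => X z t) θ - lift (fun z => X z t) φ) (lift (fun z => ν z t) θ)
        - μ * curvature (fun z => X z t) (fun z => ν z t) θ
          * ‖lift (fun z => X z t) θ - lift (fun z => X z t) φ‖ ^ 2 := by
  rw [inner_plane, norm_sq_plane]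
  rfl

/-- Positivity of the curvature disappears from the right side, since it follows from nonpositivity
of the two-point function. -/
theorem isNonCollapsed_iff_twoPoint (hT : 0 < T) (h : IsConvexPowerCurvatureFlow p T X ν)
    {μ t : ℝ} (hμ : 0 < μ) (ht : t ∈ Ico 0 T) :
    IsNonCollapsed μ (fun z => X z t) (fun z => ν z t) ↔
      ∀ θ φ, (h.toFramedFlow hT).twoPoint μ θ φ t ≤ 0 := by
  rw [isNonCollapsed_iff (h.convexEmbedding t ht) (h.normal_lift ht) hμ]
  simp only [← h.twoPoint_toFramedFlow hT]
  exact ⟨fun H θ => (H θ).2, fun H θ => ⟨(h.toFramedFlow hT).curvature_pos hμ ht H θ, H θ⟩⟩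

end IsConvexPowerCurvatureFlow

end PCF

end

theorem theorem1 (p : ℝ) (hp : 1 < p) :
    ∃ μ₀ : ℝ, 1 < μ₀ ∧
      ∀ (T : ℝ) (X ν : Circle → ℝ → PCF.Plane),
        0 < T →
        PCF.IsConvexPowerCurvatureFlow p T X ν →
        ∀ μ : ℝ, 1 ≤ μ → μ ≤ μ₀ →
          PCF.IsNonCollapsed μ (fun z => X z 0) (fun z => ν z 0) →
          ∀ t ∈ Set.Ico 0 T, PCF.IsNonCollapsed μ (fun z => X z t) (fun z => ν z t) := by
  obtain ⟨μ₀, hμ₀, hpinch⟩ := PCF.exists_pinching_constant hp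
  refine ⟨μ₀, hμ₀, fun T X ν hT h μ hμ hμ' h0 t ht => ?_⟩
  have hμ0 : 0 < μ := by linarith
  rw [h.isNonCollapsed_iff_twoPoint hT hμ0 ⟨le_rfl, hT⟩] at h0
  rw [h.isNonCollapsed_iff_twoPoint hT hμ0 ht]
  exact fun θ φ => (h.toFramedFlow hT).twoPoint_nonpos hp hμ₀ hpinch hμ hμ' h0 ht θ φ
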